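/- Let $G$ be a discrete group, $H\le G$ a subgroup and $A=C^*(H)$ the full group $C^*$-algebra of $H$. Let $X$ be the $A$-correspondence of Rieffel induction from $H$ to $G$ with the left action restricted to $C^*(H)$: the completion of $c_c(G)=\operatorname{span}G$, on which $H$ acts by left and right multiplication, for the inner product $\langle s,t\rangle_A=s^{-1}t$ if $sH=tH$ and $\langle s,t\rangle_A=0$ otherwise ($s,t\in G$). For a $C^*$-correspondence $Z$ let $\mathcal O_Z$ be its Cuntz–Pimsner algebra, universal for Toeplitz representations $(\psi,\pi)$ with $\psi^{(1)}\circ\varphi=\pi$ on the Katsura ideal $J_Z=\varphi^{-1}(\mathcal K(Z))\cap(\ker\varphi)^\perp$. Let $\eta\colon G/H\to G$ be a cross section and put $\kappa(h,tH)=\eta(htH)^{-1}h\,\eta(tH)\in H$ for $h\in H$, $tH\in G/H$. Let $E$ be the directed graph with one vertex $v$ and edge set $E^1=G/H$, and let $H$ act on $E$ by fixing $v$ and by left translation on $G/H$. 1. $\kappa$ is a cocycle for the action of $H$ on $E$, that is, $\kappa(gh,e)=\kappa(g,he)\,\kappa(h,e)$ and $\kappa(h,e)s(e)=h\,s(e)$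 for $g,h\in H$ and $e\in E^1$ (where $s(e)$ is the source of $e$). The correspondence $X$ is isomorphic, as an $A$-correspondence, to the Exel–Pardo correspondence $Y^\kappa$, which is the completion of $c_c(G/H\times H)$ for the operations $h(e,k)=(he,\kappa(h,e)k)$, $(e,k)h=(e,kh)$, and $\langle(e,h),(f,k)\rangle_A=h^{-1}k$ if $e=f$ and $0$ otherwise. Hence $\mathcal O_X$ is isomorphic to the Exel–Pardo algebra $\mathcal O_{Y^\kappa}$. 2. If $H$ has finite index in $G$, then $E$ is a finite graph, and $\kappa$ is a cocycle such that $\kappa(h,e)$ acts like $h$ on the vertices. Then $X$ is isomorphic, as an $A$-correspondence, to the correspondence $M$ of Exel and Pardo, that is, the free Hilbert $A$-module $A^{G/H}$ with standard basis $(t_e)_{e\in G/H}$ and left action $h(t_e a)=t_{he}\,\kappa(h,e)a$. Moreover $\mathcal O_X$ is isomorphic to the Exel–Pardo algebra $\mathcal O_{H,G/H}$, the universal unital $C^*$-algebra generated by elements $p_v$, $s_e$ ($e\in E^1$) and $u_h$ ($h\in H$) such that $\{p_v\}\cup\{s_e\}$ is a Cuntz–Krieger $E$-family with $p_v=1$,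 $h\mapsto u_h$ is a unitary representation of $H$, $u_hs_e=s_{he}u_{\kappa(h,e)}$ and $u_hp_v=p_{hv}u_h$. -/

import Mathlib

noncomputable section

open UniformSpace

/-! ### C*-seminorms and the full group C*-algebra of a discrete group -/

/-- The complex group algebra of `H`, i.e. `c_c(H)` with convolution. -/
def GroupAlg (H : Type*) [Group H] : Type _ := MonoidAlgebra ℂ H

namespace GroupAlg

variable {H : Type*} [Group H]

instance : Ring (GroupAlg H) := inferInstanceAs (Ring (MonoidAlgebra ℂ H))
instance : Algebra ℂ (GroupAlg H) := inferInstanceAs (Algebra ℂ (MonoidAlgebra ℂ H))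

/-- A group element, viewed as the characteristic function of its singleton. -/
def of (h : H) : GroupAlg H := MonoidAlgebra.single h (1 : ℂ)

theorem of_mul (g h : H) : of (g * h) = of g * of h := by
  exact ((MonoidAlgebra.single_mul_single g h (1 : ℂ) 1).trans (by rw [one_mul]; rfl)).symm

theorem smul_of (c : ℂ) (h : H) : c • of h = (MonoidAlgebra.single h c : MonoidAlgebra ℂ H) :=
  (MonoidAlgebra.smul_single c h (1 : ℂ)).trans (by simp)

theorem of_one : of (1 : H) = 1 := rfl

theorem induction {P : GroupAlg H → Prop} (f : GroupAlg H) (h0 : P 0)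
    (hadd : ∀ a b, P a → P b → P (a + b)) (hsm : ∀ (c : ℂ) h, P (c • of h)) : P f := by
  refine MonoidAlgebra.induction_linear (motive := P) f h0 hadd ?_
  intro h c
  have := hsm c h
  rwa [smul_of] at this

/-- The involution `f*(h) = conj (f (h⁻¹))`. -/
instance : Star (GroupAlg H) where
  star f := (MonoidAlgebra.ofCoeff
    ((f : MonoidAlgebra ℂ H).coeff.sum fun h c => Finsupp.single h⁻¹ (star c)) : MonoidAlgebra ℂ H)

theorem star_add' (f g : GroupAlg H) : star (f + g) = star f + star g := by
  apply MonoidAlgebra.coeff_injective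
  exact Finsupp.sum_add_index' (f := MonoidAlgebra.coeff f) (g := MonoidAlgebra.coeff g)
    (h := fun h c => Finsupp.single h⁻¹ (star c)) (fun h => by rw [star_zero, Finsupp.single_zero])
    (fun h b c => by rw [star_add, Finsupp.single_add])

theorem star_smul_of (c : ℂ) (h : H) : star (c • of h : GroupAlg H) = star c • of h⁻¹ := by
  rw [smul_of, smul_of]
  apply MonoidAlgebra.coeff_injective
  exact Finsupp.sum_single_index (a := h) (b := c)
    (h := fun h c => Finsupp.single h⁻¹ (star c)) (by rw [star_zero, Finsupp.single_zero])

theorem star_zero' : star (0 : GroupAlg H) = 0 := by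
  have := star_add' (0 : GroupAlg H) 0
  simpa using this

instance : StarRing (GroupAlg H) where
  star_involutive f := by
    induction f using induction with
    | h0 => rw [star_zero', star_zero']
    | hadd a b ha hb => rw [star_add', star_add', ha, hb]
    | hsm c h => rw [star_smul_of, star_smul_of]; simp
  star_add := star_add'
  star_mul f g := by
    induction f using induction with
    | h0 => simp [star_zero']
    | hadd a b ha hb => rw [add_mul, star_add', star_add', ha, hb, mul_add]
    | hsm c h =>
      induction g using induction with
      | h0 => simp [star_zero']
      | hadd a b ha hb => rw [mul_add, star_add', star_add', ha, hb, add_mul]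
      | hsm d k =>
        rw [smul_mul_smul_comm, ← of_mul, star_smul_of, star_smul_of, star_smul_of,
          smul_mul_smul_comm, ← of_mul]
        simp [mul_comm]

instance : StarModule ℂ (GroupAlg H) where
  star_smul c f := by
    induction f using induction with
    | h0 => simp
    | hadd a b ha hb => rw [smul_add, star_add, ha, hb, star_add, smul_add]
    | hsm d k => rw [smul_smul, star_smul_of, star_smul_of, smul_smul, star_mul']

theorem star_of (h : H) : star (of h) = of h⁻¹ := by
  simpa using star_smul_of 1 h

/-- A C*-seminorm on the group algebra, i.e. the pull-back of the norm of a C*-algebra along a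
*-homomorphism. -/
structure CStarSeminorm (H : Type*) [Group H] extends Seminorm ℂ (GroupAlg H) where
  mul_le' : ∀ a b, toFun (a * b) ≤ toFun a * toFun b
  star_mul_self' : ∀ a, toFun (star a * a) = toFun a ^ 2

instance : CoeFun (CStarSeminorm H) fun _ => GroupAlg H → ℝ := ⟨fun q => q.toSeminorm⟩

instance : Nonempty (CStarSeminorm H) :=
  ⟨{ (0 : Seminorm ℂ (GroupAlg H)) with
      mul_le' := fun a b => by change (0 : ℝ) ≤ 0 * 0; simp
      star_mul_self' := fun a => by change (0 : ℝ) = 0 ^ 2; simp }⟩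

theorem CStarSeminorm.mul_le (q : CStarSeminorm H) (a b) : q (a * b) ≤ q a * q b := q.mul_le' a b
theorem CStarSeminorm.star_mul_self (q : CStarSeminorm H) (a) : q (star a * a) = q a ^ 2 :=
  q.star_mul_self' a

theorem CStarSeminorm.of_le (q : CStarSeminorm H) (h : H) : q (of h) ≤ 1 := by
  have h1 : q 1 = q 1 ^ 2 := by simpa using q.star_mul_self 1
  have h2 : q (1 : GroupAlg H) = q (of h) ^ 2 := by
    rw [← q.star_mul_self, star_of, ← of_mul]; simp [of_one]
  have h0 : 0 ≤ q (of h) := apply_nonneg q.toSeminorm _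
  nlinarith [sq_nonneg (q (of h) ^ 2 - 1), sq_nonneg (q (of h) - 1)]

theorem CStarSeminorm.star_le (q : CStarSeminorm H) (a) : q (star a) ≤ q a := by
  have h0 : 0 ≤ q a := apply_nonneg q.toSeminorm _
  have h0' : 0 ≤ q (star a) := apply_nonneg q.toSeminorm _
  have h := q.star_mul_self (star a)
  have h2 := q.mul_le (star (star a)) (star a)
  rw [star_star] at h h2
  rcases h0'.eq_or_lt with h3 | h3
  · rw [← h3]; exact h0
  · nlinarith

theorem bddAbove (f : GroupAlg H) : BddAbove (Set.range fun q : CStarSeminorm H => q f) := by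
  induction f using induction with
  | h0 => exact ⟨0, by rintro _ ⟨q, rfl⟩; simp⟩
  | hadd a b ha hb =>
    obtain ⟨C, hC⟩ := ha
    obtain ⟨D, hD⟩ := hb
    refine ⟨C + D, ?_⟩
    rintro _ ⟨q, rfl⟩
    exact (map_add_le_add q.toSeminorm a b).trans (add_le_add (hC ⟨q, rfl⟩) (hD ⟨q, rfl⟩))
  | hsm c h =>
    refine ⟨‖c‖, ?_⟩
    rintro _ ⟨q, rfl⟩
    change q.toSeminorm _ ≤ _
    rw [map_smul_eq_mul]
    exact mul_le_of_le_one_right (norm_nonneg _) (q.of_le h)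

/-- The full C*-norm on the group algebra: the supremum of all its C*-seminorms. -/
def cnorm (f : GroupAlg H) : ℝ := ⨆ q : CStarSeminorm H, q f

theorem le_cnorm (q : CStarSeminorm H) (f : GroupAlg H) : q f ≤ cnorm f :=
  le_ciSup (bddAbove f) q

theorem cnorm_nonneg (f : GroupAlg H) : 0 ≤ cnorm f :=
  Real.iSup_nonneg fun q => apply_nonneg q.toSeminorm f

theorem cnorm_add (f g : GroupAlg H) : cnorm (f + g) ≤ cnorm f + cnorm g :=
  ciSup_le fun q => (map_add_le_add q.toSeminorm f g).trans
    (add_le_add (le_cnorm q f) (le_cnorm q g))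

theorem cnorm_smul (c : ℂ) (f : GroupAlg H) : cnorm (c • f) = ‖c‖ * cnorm f := by
  unfold cnorm
  rw [Real.mul_iSup_of_nonneg (norm_nonneg c)]
  exact congrArg _ (funext fun q => map_smul_eq_mul q.toSeminorm c f)

theorem cnorm_mul (f g : GroupAlg H) : cnorm (f * g) ≤ cnorm f * cnorm g :=
  ciSup_le fun q => (q.mul_le f g).trans
    (mul_le_mul (le_cnorm q f) (le_cnorm q g) (apply_nonneg q.toSeminorm _) (cnorm_nonneg f))

theorem cnorm_star (f : GroupAlg H) : cnorm (star f) ≤ cnorm f :=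
  ciSup_le fun q => (q.star_le f).trans (le_cnorm q f)

theorem cnorm_sq_le (f : GroupAlg H) : cnorm f * cnorm f ≤ cnorm (star f * f) := by
  have h : cnorm f ≤ √(cnorm (star f * f)) := ciSup_le fun q => by
    apply Real.le_sqrt_of_sq_le
    rw [← q.star_mul_self]
    exact le_cnorm q _
  calc cnorm f * cnorm f ≤ √(cnorm (star f * f)) * √(cnorm (star f * f)) :=
        mul_le_mul h h (cnorm_nonneg f) (Real.sqrt_nonneg _)
    _ = _ := Real.mul_self_sqrt (cnorm_nonneg _)

instance : Norm (GroupAlg H) := ⟨cnorm⟩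

theorem seminormedCore : SeminormedSpace.Core ℂ (GroupAlg H) where
  norm_nonneg := cnorm_nonneg
  norm_smul := cnorm_smul
  norm_triangle := cnorm_add

instance : SeminormedAddCommGroup (GroupAlg H) := SeminormedAddCommGroup.ofCore seminormedCore

instance : SeminormedRing (GroupAlg H) where
  dist_eq := SeminormedAddCommGroup.dist_eq
  norm_mul_le := cnorm_mul

instance : NormedAlgebra ℂ (GroupAlg H) where
  norm_smul_le c f := (cnorm_smul c f).le

theorem norm_of_le (h : H) : ‖of h‖ ≤ 1 := ciSup_le fun q => q.of_le h

end GroupAlg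

/-- The full group C*-algebra `C*(H)` of the discrete group `H`: the (Hausdorff) completion of the
group algebra in its full C*-norm. -/
def GroupCStar (H : Type*) [Group H] : Type _ := Completion (GroupAlg H)

namespace GroupCStar

variable {H : Type*} [Group H]

instance : NormedRing (GroupCStar H) := inferInstanceAs (NormedRing (Completion (GroupAlg H)))
instance : CompleteSpace (GroupCStar H) :=
  inferInstanceAs (CompleteSpace (Completion (GroupAlg H)))
instance : Algebra ℂ (GroupCStar H) := inferInstanceAs (Algebra ℂ (Completion (GroupAlg H)))
instance : NormedAlgebra ℂ (GroupCStar H) where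
  norm_smul_le c (f : Completion (GroupAlg H)) := norm_smul_le c f

/-- The canonical map of the group algebra to the group C*-algebra. -/
def ι (f : GroupAlg H) : GroupCStar H := (f : Completion (GroupAlg H))

theorem ι_add (f g : GroupAlg H) : ι (f + g) = ι f + ι g := Completion.coe_add f g
theorem ι_mul (f g : GroupAlg H) : ι (f * g) = ι f * ι g := Completion.coe_mul f g
theorem ι_smul (c : ℂ) (f : GroupAlg H) : ι (c • f) = c • ι f := Completion.coe_smul c f
theorem ι_one : ι (1 : GroupAlg H) = 1 := rfl
theorem ι_zero : ι (0 : GroupAlg H) = 0 := rfl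
theorem norm_ι (f : GroupAlg H) : ‖ι f‖ = ‖f‖ := Completion.norm_coe f
theorem continuous_ι : Continuous (ι : GroupAlg H → GroupCStar H) := Completion.continuous_coe _
theorem denseRange_ι : DenseRange (ι : GroupAlg H → GroupCStar H) := Completion.denseRange_coe

theorem uniformContinuous_star : UniformContinuous (star : GroupAlg H → GroupAlg H) :=
  (LipschitzWith.of_dist_le_mul (K := 1) fun f g => by
    rw [dist_eq_norm, dist_eq_norm, ← star_sub]
    rw [NNReal.coe_one, one_mul]
    exact GroupAlg.cnorm_star (f - g)).uniformContinuous

instance : Star (GroupCStar H) :=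
  ⟨fun a => Completion.map (star : GroupAlg H → GroupAlg H) a⟩

theorem star_ι (f : GroupAlg H) : star (ι f) = ι (star f) :=
  Completion.map_coe uniformContinuous_star f

theorem continuous_star' : Continuous (star : GroupCStar H → GroupCStar H) :=
  Completion.continuous_map

instance : ContinuousStar (GroupCStar H) := ⟨continuous_star'⟩

theorem induction {P : GroupCStar H → Prop} (a : GroupCStar H) (hc : IsClosed {a | P a})
    (h : ∀ f : GroupAlg H, P (ι f)) : P a := Completion.induction_on a hc h

theorem induction₂ {P : GroupCStar H → GroupCStar H → Prop} (a b : GroupCStar H)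
    (hc : IsClosed {p : GroupCStar H × GroupCStar H | P p.1 p.2})
    (h : ∀ f g : GroupAlg H, P (ι f) (ι g)) : P a b := Completion.induction_on₂ a b hc h

instance : StarRing (GroupCStar H) where
  star_involutive a := by
    refine induction (P := fun a => star (star a) = a) a (isClosed_eq (by fun_prop) (by fun_prop)) ?_
    intro f
    rw [star_ι, star_ι, star_star]
  star_add a b := by
    refine induction₂ (P := fun a b => star (a + b) = star a + star b) a b
      (isClosed_eq (by fun_prop) (by fun_prop)) ?_
    intro f g
    rw [← ι_add, star_ι, star_ι, star_ι, star_add, ι_add]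
  star_mul a b := by
    refine induction₂ (P := fun a b => star (a * b) = star b * star a) a b
      (isClosed_eq (by fun_prop) (by fun_prop)) ?_
    intro f g
    rw [← ι_mul, star_ι, star_ι, star_ι, star_mul, ι_mul]

instance : StarModule ℂ (GroupCStar H) where
  star_smul c a := by
    refine induction (P := fun a => star (c • a) = star c • star a) a (isClosed_eq
      (continuous_star'.comp (continuous_const_smul c))
      ((continuous_const_smul (star c)).comp continuous_star')) fun f => ?_
    rw [← ι_smul, star_ι, star_ι, star_smul, ι_smul]

instance : CStarAlgebra (GroupCStar H) where
  norm_mul_self_le a := by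
    refine induction (P := fun a => ‖a‖ * ‖a‖ ≤ ‖star a * a‖) a
      (isClosed_le (by fun_prop) (by fun_prop)) ?_
    intro f
    rw [star_ι, ← ι_mul, norm_ι, norm_ι]
    exact GroupAlg.cnorm_sq_le f
  star_smul := star_smul

/-- The usual order of a C*-algebra: `0 ≤ a` iff `a = b* b` for some `b`. -/
instance : PartialOrder (GroupCStar H) := CStarAlgebra.spectralOrder _
instance : StarOrderedRing (GroupCStar H) := CStarAlgebra.spectralOrderedRing _

/-- The canonical unitary in `C*(H)` of a group element. -/
def u (h : H) : GroupCStar H := ι (GroupAlg.of h)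

end GroupCStar

end

/-! ### C*-correspondences -/

noncomputable section

open MulOpposite CStarModule
open scoped ENNReal

universe u v

/-- A C*-correspondence over `A`: a right Hilbert `A`-module with a left action of `A` by adjointable
operators. A `CStarModule` of Mathlib is a left module with an inner product that is `A`-linear in
the second variable; a right Hilbert `A`-module, with inner product linear in the second variable,
is therefore a `CStarModule` over the opposite algebra `Aᵐᵒᵖ`. -/
structure Correspondence (A : Type u) [NonUnitalCStarAlgebra A] [PartialOrder A]
    [StarOrderedRing A] where
  carrier : Type u
  [normedAddCommGroup : NormedAddCommGroup carrier]
  [normedSpace : NormedSpace ℂ carrier]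
  [completeSpace : CompleteSpace carrier]
  [rightSMul : SMul Aᵐᵒᵖ carrier]
  [cstarModule : CStarModule Aᵐᵒᵖ carrier]
  /-- the left action -/
  φ : A →ₙₐ[ℂ] (carrier →L[ℂ] carrier)
  inner_φ : ∀ a x y, inner Aᵐᵒᵖ (φ a x) y = inner Aᵐᵒᵖ x (φ (star a) y)

namespace Correspondence

attribute [instance] normedAddCommGroup normedSpace completeSpace rightSMul cstarModule

section

variable {A : Type u} [NonUnitalCStarAlgebra A] [PartialOrder A] [StarOrderedRing A]

instance : CoeSort (Correspondence A) (Type u) := ⟨carrier⟩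

variable (X Y : Correspondence A)

/-- The `A`-valued inner product `⟨x, y⟩_A`. -/
def ip {X : Correspondence A} (x y : X) : A := unop (inner Aᵐᵒᵖ x y)

/-- The right action `x a`. -/
def rmul {X : Correspondence A} (x : X) (a : A) : X := op a • x

variable {X}

theorem ip_rmul (x y : X) (a : A) : ip x (rmul y a) = ip x y * a := by
  simp [ip, rmul]

theorem star_ip (x y : X) : star (ip x y) = ip y x := by
  rw [ip, ip, ← unop_star, CStarModule.star_inner]

theorem ip_add (x y z : X) : ip x (y + z) = ip x y + ip x z := by simp [ip]

theorem ip_smul (c : ℂ) (x y : X) : ip x (c • y) = c • ip x y := by simp [ip]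

theorem norm_sq (x : X) : ‖x‖ ^ 2 = ‖ip x x‖ := CStarModule.norm_sq_eq Aᵐᵒᵖ

theorem norm_ip_le (x y : X) : ‖ip x y‖ ≤ ‖x‖ * ‖y‖ := CStarModule.norm_inner_le (A := Aᵐᵒᵖ) X

theorem ext_ip {x y : X} (h : ∀ z, ip z x = ip z y) : x = y := by
  rw [← sub_eq_zero, ← CStarModule.inner_self (A := Aᵐᵒᵖ), CStarModule.inner_sub_right]
  exact sub_eq_zero.2 (unop_injective (h (x - y)))

theorem rmul_add (x : X) (a b : A) : rmul x (a + b) = rmul x a + rmul x b :=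
  ext_ip fun z => by simp [ip_rmul, ip_add, mul_add]

theorem rmul_smul (x : X) (c : ℂ) (a : A) : rmul x (c • a) = c • rmul x a :=
  ext_ip fun z => by rw [ip_rmul, ip_smul, ip_rmul, mul_smul_comm]

theorem norm_rmul_le (x : X) (a : A) : ‖rmul x a‖ ≤ ‖x‖ * ‖a‖ := by
  have h : ‖rmul x a‖ ^ 2 ≤ (‖x‖ * ‖a‖) ^ 2 := by
    have e : ip (rmul x a) (rmul x a) = star a * (ip x x * a) := by
      rw [ip_rmul, ← star_ip, ip_rmul, star_mul, star_ip, mul_assoc]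
    rw [norm_sq, e]
    calc ‖star a * (ip x x * a)‖ ≤ ‖star a‖ * (‖ip x x‖ * ‖a‖) :=
          (norm_mul_le _ _).trans (by gcongr; exact norm_mul_le _ _)
      _ = (‖x‖ * ‖a‖) ^ 2 := by rw [norm_star, ← norm_sq]; ring
  exact le_of_sq_le_sq h (by positivity)

/-- The generalized rank-one operator `θ_{x,y} z = x ⟨y, z⟩_A`. -/
def theta (x y : X) : X →L[ℂ] X :=
  LinearMap.mkContinuous
    { toFun := fun z => rmul x (ip y z)
      map_add' := fun z w => by rw [ip_add, rmul_add]
      map_smul' := fun c z => by rw [ip_smul, rmul_smul, RingHom.id_apply] }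
    (‖x‖ * ‖y‖) fun z => by
      refine (norm_rmul_le _ _).trans ?_
      rw [mul_assoc]
      exact mul_le_mul_of_nonneg_left (norm_ip_le y z) (norm_nonneg x)

variable (X)

/-- The generalized compact operators `K(X)`: the closed linear span of the rank-one operators. -/
def compacts : Submodule ℂ (X →L[ℂ] X) :=
  (Submodule.span ℂ {T | ∃ x y : X, T = theta x y}).topologicalClosure

variable {X} in
/-- The rank-one operator `θ_{x,y}` as an element of `K(X)`. -/
def thetaK (x y : X) : X.compacts :=
  ⟨theta x y, Submodule.le_topologicalClosure _ (Submodule.subset_span ⟨x, y, rfl⟩)⟩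

/-- The Katsura ideal `J_X = φ⁻¹(K(X)) ∩ (ker φ)^⊥`. -/
def katsuraIdeal : Set A :=
  {a | X.φ a ∈ X.compacts ∧ ∀ b, X.φ b = 0 → a * b = 0}

/-- An isomorphism of `A`-correspondences. -/
structure Iso (X Y : Correspondence A) where
  toEquiv : X ≃ₗ[ℂ] Y
  map_ip : ∀ x y, ip (toEquiv x) (toEquiv y) = ip x y
  map_left : ∀ (a : A) (x : X), toEquiv (X.φ a x) = Y.φ a (toEquiv x)
  map_right : ∀ (x : X) (a : A), toEquiv (rmul x a) = rmul (toEquiv x) a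

/-! ### Representations and the Cuntz-Pimsner algebra -/

/-- A Toeplitz representation `(ψ, π)` of `X` in the C*-algebra `B`. -/
structure ToeplitzRep (B : Type v) [NonUnitalCStarAlgebra B] where
  ψ : X →ₗ[ℂ] B
  π : A →⋆ₙₐ[ℂ] B
  map_left : ∀ a x, ψ (X.φ a x) = π a * ψ x
  map_ip : ∀ x y, star (ψ x) * ψ y = π (ip x y)

variable {X} in
/-- Cuntz-Pimsner covariance: `ψ⁽¹⁾ (φ a) = π a` for all `a ∈ J_X`, where `ψ⁽¹⁾` is the (unique)
homomorphism on `K(X)` with `ψ⁽¹⁾ (θ_{x,y}) = ψ(x) ψ(y)*`. -/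
def ToeplitzRep.IsCovariant {B : Type v} [NonUnitalCStarAlgebra B] (ρ : X.ToeplitzRep B) : Prop :=
  ∃ ψ₁ : X.compacts →L[ℂ] B, (∀ x y, ψ₁ (thetaK x y) = ρ.ψ x * star (ρ.ψ y)) ∧
    ∀ (a : A) (ha : a ∈ X.katsuraIdeal), ψ₁ ⟨X.φ a, ha.1⟩ = ρ.π a

variable {X} in
theorem ToeplitzRep.norm_π_le {B : Type v} [NonUnitalCStarAlgebra B] (ρ : X.ToeplitzRep B)
    (a : A) : ‖ρ.π a‖ ≤ ‖a‖ := NonUnitalStarAlgHom.norm_apply_le ρ.π a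

variable {X} in
theorem ToeplitzRep.norm_ψ_le {B : Type v} [NonUnitalCStarAlgebra B] (ρ : X.ToeplitzRep B)
    (x : X) : ‖ρ.ψ x‖ ≤ ‖x‖ := by
  have h : ‖ρ.ψ x‖ ^ 2 ≤ ‖x‖ ^ 2 := by
    rw [norm_sq, sq, ← CStarRing.norm_star_mul_self, ρ.map_ip]
    exact ρ.norm_π_le _
  exact le_of_sq_le_sq h (norm_nonneg x)

/-- The Cuntz-Pimsner covariant representations of `X` in C*-algebras. The universe bounds only the
size of the C*-algebra, and every C*-algebra generated by a representation of `X` is as small as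
that up to isomorphism. -/
structure CovariantRep where
  B : Type u
  [cstar : NonUnitalCStarAlgebra B]
  rep : X.ToeplitzRep B
  covariant : rep.IsCovariant

attribute [instance] CovariantRep.cstar

/-- The product of the target algebras of all covariant representations. -/
abbrev CovariantProduct : Type (u + 1) := lp (fun ρ : X.CovariantRep => ρ.B) ∞

/-- The universal covariant representation on elements of `X`. -/
def kX (x : X) : X.CovariantProduct :=
  ⟨fun ρ => ρ.rep.ψ x, memℓp_infty ⟨‖x‖, by rintro _ ⟨ρ, rfl⟩; exact ρ.rep.norm_ψ_le x⟩⟩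

/-- The universal covariant representation on elements of `A`. -/
def kA (a : A) : X.CovariantProduct :=
  ⟨fun ρ => ρ.rep.π a, memℓp_infty ⟨‖a‖, by rintro _ ⟨ρ, rfl⟩; exact ρ.rep.norm_π_le a⟩⟩

/-- The Cuntz-Pimsner algebra `O_X`, as a C*-subalgebra of a product: it is generated by the
universal covariant representation `(k_X, k_A)`, the direct sum of all covariant ones. -/
def cuntzPimsnerSubalgebra : NonUnitalStarSubalgebra ℂ X.CovariantProduct :=
  (NonUnitalStarAlgebra.adjoin ℂ (Set.range X.kX ∪ Set.range X.kA)).topologicalClosure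

/-- The Cuntz-Pimsner algebra `O_X`. -/
def CuntzPimsner : Type (u + 1) := X.cuntzPimsnerSubalgebra

instance : NonUnitalCStarAlgebra X.CuntzPimsner :=
  NonUnitalStarSubalgebra.nonUnitalCStarAlgebra X.cuntzPimsnerSubalgebra
    (h_closed := NonUnitalStarSubalgebra.isClosed_topologicalClosure _)

end

end Correspondence

end

/-! ### Integrated forms and completions of precorrespondences -/

noncomputable section

open UniformSpace MulOpposite

universe u

namespace UnitaryRep

/-! A unitary representation `U` of a discrete group `H` on a right Hilbert `A`-module `E`
integrates to a left action of `C*(H)`. -/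

variable {H : Type*} [Group H] {A : Type*} [NonUnitalCStarAlgebra A] [PartialOrder A]
  [StarOrderedRing A] {E : Type*} [NormedAddCommGroup E] [NormedSpace ℂ E] [SMul Aᵐᵒᵖ E]
  [CStarModule Aᵐᵒᵖ E] (U : H →* (E →L[ℂ] E))

/-- The extension of `U` to the group algebra. -/
def algHom : GroupAlg H →ₐ[ℂ] (E →L[ℂ] E) := MonoidAlgebra.lift ℂ _ H U

theorem algHom_of (h : H) : algHom U (GroupAlg.of h) = U h := by
  have := MonoidAlgebra.lift_single (R := ℂ) U h 1
  rw [one_smul] at this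
  exact this

set_option linter.unusedSectionVars false

theorem inner_algHom
    (hU : ∀ h x y, inner Aᵐᵒᵖ (U h x) (U h y) = inner Aᵐᵒᵖ x y)
    (f : GroupAlg H) (x y : E) :
    inner Aᵐᵒᵖ (algHom U f x) y = inner Aᵐᵒᵖ x (algHom U (star f) y) := by
  induction f using GroupAlg.induction with
  | h0 => simp
  | hadd a b ha hb => simp [ha, hb]
  | hsm c h =>
    rw [star_smul, GroupAlg.star_of, map_smul, map_smul, algHom_of, algHom_of]
    have : y = U h (U h⁻¹ y) := by
      rw [← mul_apply_eq_comp, ← map_mul]; simp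
    conv_lhs => rw [this]
    simp [hU]

theorem norm_algHom_sq_le
    (hU : ∀ h x y, inner Aᵐᵒᵖ (U h x) (U h y) = inner Aᵐᵒᵖ x y)
    (f : GroupAlg H) :
    ‖algHom U f‖ ^ 2 ≤ ‖algHom U (star f * f)‖ := by
  have key : ‖algHom U f‖ ≤ √‖algHom U (star f * f)‖ := by
    refine ContinuousLinearMap.opNorm_le_bound _ (Real.sqrt_nonneg _) fun x => ?_
    have h1 : ‖algHom U f x‖ ^ 2 ≤ (√‖algHom U (star f * f)‖ * ‖x‖) ^ 2 := by
      rw [CStarModule.norm_sq_eq Aᵐᵒᵖ, inner_algHom U hU, mul_pow, Real.sq_sqrt (norm_nonneg _),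
        ← mul_apply_eq_comp, ← map_mul]
      calc _ ≤ ‖x‖ * ‖algHom U (star f * f) x‖ := CStarModule.norm_inner_le E
        _ ≤ ‖x‖ * (‖algHom U (star f * f)‖ * ‖x‖) := by
            gcongr; exact ContinuousLinearMap.le_opNorm _ _
        _ = _ := by ring
    exact le_of_sq_le_sq h1 (by positivity)
  calc ‖algHom U f‖ ^ 2 ≤ √‖algHom U (star f * f)‖ ^ 2 := by gcongr
    _ = _ := Real.sq_sqrt (norm_nonneg _)

theorem norm_algHom_star_le
    (hU : ∀ h x y, inner Aᵐᵒᵖ (U h x) (U h y) = inner Aᵐᵒᵖ x y)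
    (f : GroupAlg H) : ‖algHom U f‖ ≤ ‖algHom U (star f)‖ := by
  have h := norm_algHom_sq_le U hU f
  rw [map_mul] at h
  have h2 := h.trans (norm_mul_le _ _)
  rcases (norm_nonneg (algHom U f)).eq_or_lt with h3 | h3
  · rw [← h3]; exact norm_nonneg _
  · rw [sq] at h2; exact le_of_mul_le_mul_right h2 h3

/-- The operator norm of the integrated form is a C*-seminorm. -/
def cstarSeminorm
    (hU : ∀ h x y, inner Aᵐᵒᵖ (U h x) (U h y) = inner Aᵐᵒᵖ x y) :
    GroupAlg.CStarSeminorm H :=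
  { (normSeminorm ℂ (E →L[ℂ] E)).comp (algHom U).toLinearMap with
    mul_le' := fun a b => by
      change ‖algHom U (a * b)‖ ≤ ‖algHom U a‖ * ‖algHom U b‖
      rw [map_mul]; exact norm_mul_le _ _
    star_mul_self' := fun a => by
      change ‖algHom U (star a * a)‖ = ‖algHom U a‖ ^ 2
      refine le_antisymm ?_ (norm_algHom_sq_le U hU a)
      have := norm_algHom_star_le U hU (star a)
      rw [star_star] at this
      rw [map_mul, sq]
      exact (norm_mul_le _ _).trans (by gcongr) }

theorem norm_algHom_le
    (hU : ∀ h x y, inner Aᵐᵒᵖ (U h x) (U h y) = inner Aᵐᵒᵖ x y)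
    (f : GroupAlg H) : ‖algHom U f‖ ≤ ‖f‖ :=
  GroupAlg.le_cnorm (cstarSeminorm U hU) f

theorem uniformContinuous_algHom
    (hU : ∀ h x y, inner Aᵐᵒᵖ (U h x) (U h y) = inner Aᵐᵒᵖ x y) : UniformContinuous (algHom U) :=
  (LipschitzWith.of_dist_le_mul (K := 1) fun f g => by
    rw [dist_eq_norm, dist_eq_norm, ← map_sub, NNReal.coe_one, one_mul]
    exact norm_algHom_le U hU _).uniformContinuous

variable [CompleteSpace E]

/-- The continuous extension of the integrated form to `C*(H)`. -/
def extend (a : GroupCStar H) : E →L[ℂ] E := Completion.extension (algHom U) a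

theorem continuous_extend : Continuous (extend U) := Completion.continuous_extension

theorem extend_ι
    (hU : ∀ h x y, inner Aᵐᵒᵖ (U h x) (U h y) = inner Aᵐᵒᵖ x y)
    (f : GroupAlg H) : extend U (GroupCStar.ι f) = algHom U f :=
  Completion.extension_coe (uniformContinuous_algHom U hU) f

/-- The integrated form of `U`, as a left action of `C*(H)`. -/
def integrated
    (hU : ∀ h x y, inner Aᵐᵒᵖ (U h x) (U h y) = inner Aᵐᵒᵖ x y) :
    GroupCStar H →ₙₐ[ℂ] (E →L[ℂ] E) where
  toFun := extend U
  map_smul' c a := GroupCStar.induction (P := fun a => extend U (c • a) = c • extend U a) a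
    (isClosed_eq ((continuous_extend U).comp (continuous_const_smul c))
      ((continuous_const_smul c).comp (continuous_extend U)))
    fun f => by rw [← GroupCStar.ι_smul, extend_ι U hU, extend_ι U hU, map_smul]
  map_zero' := by rw [← GroupCStar.ι_zero, extend_ι U hU, map_zero]
  map_add' a b := GroupCStar.induction₂
    (P := fun a b => extend U (a + b) = extend U a + extend U b) a b
    (isClosed_eq ((continuous_extend U).comp continuous_add)
      (((continuous_extend U).comp continuous_fst).add ((continuous_extend U).comp continuous_snd)))
    fun f g => by
      rw [← GroupCStar.ι_add, extend_ι U hU, extend_ι U hU, extend_ι U hU, map_add]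
  map_mul' a b := GroupCStar.induction₂
    (P := fun a b => extend U (a * b) = extend U a * extend U b) a b
    (isClosed_eq ((continuous_extend U).comp continuous_mul)
      (((continuous_extend U).comp continuous_fst).mul ((continuous_extend U).comp continuous_snd)))
    fun f g => by
      rw [← GroupCStar.ι_mul, extend_ι U hU, extend_ι U hU, extend_ι U hU, map_mul]

theorem integrated_u
    (hU : ∀ h x y, inner Aᵐᵒᵖ (U h x) (U h y) = inner Aᵐᵒᵖ x y)
    (h : H) : integrated U hU (GroupCStar.u h) = U h :=
  (extend_ι U hU _).trans (algHom_of U h)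

theorem inner_integrated
    (hU : ∀ h x y, inner Aᵐᵒᵖ (U h x) (U h y) = inner Aᵐᵒᵖ x y)
    (a : GroupCStar H) (x y : E) :
    inner Aᵐᵒᵖ (integrated U hU a x) y = inner Aᵐᵒᵖ x (integrated U hU (star a) y) := by
  refine GroupCStar.induction (P := fun a => inner Aᵐᵒᵖ (extend U a x) y =
    inner Aᵐᵒᵖ x (extend U (star a) y)) a (isClosed_eq ?_ ?_) fun f => ?_
  · have h1 : Continuous fun a => (extend U a x, y) :=
      ((continuous_extend U).clm_apply continuous_const).prodMk continuous_const
    exact (CStarModule.continuous_inner (A := Aᵐᵒᵖ) (E := E)).comp h1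
  · have h1 : Continuous fun a => (x, extend U (star a) y) :=
      continuous_const.prodMk
        (((continuous_extend U).comp GroupCStar.continuous_star').clm_apply continuous_const)
    exact (CStarModule.continuous_inner (A := Aᵐᵒᵖ) (E := E)).comp h1
  · rw [GroupCStar.star_ι, extend_ι U hU, extend_ι U hU, inner_algHom U hU]

end UnitaryRep

/-- The correspondence over `C*(H)` given by a right Hilbert `C*(H)`-module and a unitary
representation of `H` on it. -/
def Correspondence.ofUnitary {H : Type u} [Group H] (E : Type u) [NormedAddCommGroup E]
    [NormedSpace ℂ E] [CompleteSpace E] [SMul (GroupCStar H)ᵐᵒᵖ E]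
    [CStarModule (GroupCStar H)ᵐᵒᵖ E] (U : H →* (E →L[ℂ] E))
    (hU : ∀ h x y, inner (GroupCStar H)ᵐᵒᵖ (U h x) (U h y) = inner (GroupCStar H)ᵐᵒᵖ x y) :
    Correspondence (GroupCStar H) where
  carrier := E
  φ := UnitaryRep.integrated U hU
  inner_φ := UnitaryRep.inner_integrated U hU

/-- A precorrespondence over `c_c(H)`: a complex vector space with commuting linear actions of `H`
on the left and on the right and a `c_c(H)`-valued inner product, conjugate linear in the first and
linear in the second variable, such that every `⟨x, x⟩` is a finite sum of elements `f* f`,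
`⟨x, y h⟩ = ⟨x, y⟩ h` and `⟨h x, h y⟩ = ⟨x, y⟩`. -/
structure PreCorrespondence (H : Type u) [Group H] where
  V : Type u
  [addCommGroup : AddCommGroup V]
  [module : Module ℂ V]
  ip : V →ₗ⋆[ℂ] V →ₗ[ℂ] GroupAlg H
  left : H →* (V →ₗ[ℂ] V)
  right : Hᵐᵒᵖ →* (V →ₗ[ℂ] V)
  left_right : ∀ g h x, left g (right h x) = right h (left g x)
  star_ip : ∀ x y, star (ip x y) = ip y x
  ip_self : ∀ x, ∃ (n : ℕ) (f : Fin n → GroupAlg H), ip x x = ∑ i, star (f i) * f i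
  ip_right : ∀ x y h, ip x (right (op h) y) = ip x y * GroupAlg.of h
  ip_left : ∀ h x y, ip (left h x) (left h y) = ip x y

namespace PreCorrespondence

attribute [instance] addCommGroup module

/-- Continuous extension of a bounded biadditive map to completions. -/
def ext₂ {E F G : Type*} [SeminormedAddCommGroup E] [SeminormedAddCommGroup F]
    [NormedAddCommGroup G] (b : E → F → G) (x : Completion E) (y : Completion F) : G :=
  (Completion.isDenseInducing_coe.prodMap Completion.isDenseInducing_coe).extend
    (fun p : E × F => b p.1 p.2) (x, y)

section

variable {E F G : Type*} [SeminormedAddCommGroup E] [SeminormedAddCommGroup F]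
  [NormedAddCommGroup G] [NormedSpace ℂ E] [NormedSpace ℂ F] [NormedSpace ℂ G] [CompleteSpace G]
  {σ : ℂ →+* ℂ} (b : E →ₛₗ[σ] F →ₗ[ℂ] G)

theorem continuous_of_bound {C : ℝ} (hb : ∀ x y, ‖b x y‖ ≤ C * ‖x‖ * ‖y‖) :
    Continuous fun p : E × F => b p.1 p.2 :=
  ((LinearMap.mkContinuous₂ b C hb).continuous.comp continuous_fst).clm_apply continuous_snd

theorem continuous_ext₂ {C : ℝ} (hb : ∀ x y, ‖b x y‖ ≤ C * ‖x‖ * ‖y‖) :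
    Continuous fun p : Completion E × Completion F => ext₂ (fun x y => b x y) p.1 p.2 := by
  let b' : E →+ F →+ G :=
    { toFun := fun x => (b x).toAddMonoidHom
      map_zero' := by ext; simp
      map_add' := fun x y => by ext; simp }
  exact IsDenseInducing.extend_Z_bilin (φ := b') (Completion.isDenseInducing_toCompl E)
    (Completion.isDenseInducing_toCompl F) (continuous_of_bound b hb)

theorem ext₂_coe {C : ℝ} (hb : ∀ x y, ‖b x y‖ ≤ C * ‖x‖ * ‖y‖) (x : E) (y : F) :
    ext₂ (fun x y => b x y) (x : Completion E) (y : Completion F) = b x y :=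
  IsDenseInducing.extend_eq _ (continuous_of_bound b hb) (x, y)

end

variable {H : Type u} [Group H] (P : PreCorrespondence H)

/-- The inner product of a precorrespondence in `C*(H)`. -/
def ipA (x y : P.V) : GroupCStar H := GroupCStar.ι (P.ip x y)

theorem ipA_self_nonneg (x : P.V) : 0 ≤ P.ipA x x := by
  obtain ⟨n, f, hf⟩ := P.ip_self x
  have : P.ipA x x = ∑ i, star (GroupCStar.ι (f i)) * GroupCStar.ι (f i) := by
    rw [ipA, hf]
    have hs : ∀ s : Finset (Fin n), GroupCStar.ι (∑ i ∈ s, star (f i) * f i) =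
        ∑ i ∈ s, star (GroupCStar.ι (f i)) * GroupCStar.ι (f i) := by
      intro s
      induction s using Finset.cons_induction with
      | empty => rfl
      | cons a s ha ih =>
        rw [Finset.sum_cons, Finset.sum_cons, GroupCStar.ι_add, ih, GroupCStar.ι_mul,
          GroupCStar.star_ι]
    exact hs _
  rw [this]
  exact Finset.sum_nonneg fun i _ => star_mul_self_nonneg _

theorem ipA_add (x y z : P.V) : P.ipA x (y + z) = P.ipA x y + P.ipA x z := by
  rw [ipA, map_add, GroupCStar.ι_add]; rfl

theorem ipA_smul (c : ℂ) (x y : P.V) : P.ipA x (c • y) = c • P.ipA x y := by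
  rw [ipA, map_smul, GroupCStar.ι_smul]; rfl

theorem star_ipA (x y : P.V) : star (P.ipA x y) = P.ipA y x := by
  rw [ipA, GroupCStar.star_ι, P.star_ip]; rfl

theorem ipA_add_left (x y z : P.V) : P.ipA (x + y) z = P.ipA x z + P.ipA y z := by
  rw [← star_ipA, ipA_add, star_add, star_ipA, star_ipA]

theorem ipA_smul_left (c : ℂ) (x y : P.V) : P.ipA (c • x) y = star c • P.ipA x y := by
  rw [← star_ipA, ipA_smul, star_smul, star_ipA]

/-- The integrated right action `x f = ∑ f(h) x h` of the group algebra. -/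
def rightAlg : GroupAlg H →ₗ[ℂ] P.V →ₗ[ℂ] P.V :=
  (Finsupp.linearCombination ℂ fun h => P.right (op h)) ∘ₗ
    (MonoidAlgebra.coeffLinearEquiv ℂ).toLinearMap

theorem rightAlg_of (h : H) (x : P.V) : P.rightAlg (GroupAlg.of h) x = P.right (op h) x := by
  have : P.rightAlg (GroupAlg.of h) = (1 : ℂ) • P.right (op h) :=
    Finsupp.linearCombination_single ℂ 1 h
  rw [this, one_smul]

theorem ip_rightAlg (x y : P.V) (f : GroupAlg H) : P.ip x (P.rightAlg f y) = P.ip x y * f := by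
  induction f using GroupAlg.induction with
  | h0 => simp
  | hadd a b ha hb => simp [ha, hb, mul_add]
  | hsm c h => rw [map_smul, LinearMap.smul_apply, map_smul, rightAlg_of, ip_right, mul_smul_comm]

theorem ipA_rightAlg (x y : P.V) (f : GroupAlg H) :
    P.ipA x (P.rightAlg f y) = P.ipA x y * GroupCStar.ι f := by
  rw [ipA, ip_rightAlg, GroupCStar.ι_mul]; rfl

theorem ipA_rightAlg_left (x y : P.V) (f : GroupAlg H) :
    P.ipA (P.rightAlg f x) y = star (GroupCStar.ι f) * P.ipA x y := by
  rw [← star_ipA, ipA_rightAlg, star_mul, star_ipA]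

theorem ipA_cauchySchwarz (x y : P.V) : ‖P.ipA x y‖ ^ 2 ≤ ‖P.ipA x x‖ * ‖P.ipA y y‖ := by
  have key : ∀ t : ℝ, ‖P.ipA x x‖ < t → ‖P.ipA x y‖ ^ 2 ≤ t * ‖P.ipA y y‖ := by
    intro t ht
    have ht0 : 0 < t := (norm_nonneg _).trans_lt ht
    set a := P.ipA x y with ha
    have h0 := P.ipA_self_nonneg (P.rightAlg (P.ip x y) x + ((-t : ℝ) : ℂ) • y)
    have e : P.ipA (P.rightAlg (P.ip x y) x + ((-t : ℝ) : ℂ) • y)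
        (P.rightAlg (P.ip x y) x + ((-t : ℝ) : ℂ) • y) =
        star a * P.ipA x x * a - (2 * t) • (star a * a) + (t ^ 2) • P.ipA y y := by
      have ea : GroupCStar.ι (P.ip x y) = a := rfl
      have eb : P.ipA y x = star a := (P.star_ipA x y).symm
      simp only [ipA_add, ipA_add_left, ipA_smul, ipA_smul_left, ipA_rightAlg, ipA_rightAlg_left,
        ea, eb, ← ha]
      simp only [Complex.star_def, Complex.conj_ofReal, Complex.coe_smul]
      simp only [add_mul, smul_mul_assoc, mul_assoc]
      module
    rw [e] at h0
    have h1 : star a * P.ipA x x * a ≤ t • (star a * a) := by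
      refine (CStarAlgebra.star_left_conjugate_le_norm_smul
        (hb := P.star_ipA x x)).trans ?_
      exact smul_le_smul_of_nonneg_right ht.le (star_mul_self_nonneg a)
    have h2 : t • (star a * a) ≤ (t ^ 2) • P.ipA y y := by
      have h3 : 0 ≤ t • (star a * a) - (2 * t) • (star a * a) + (t ^ 2) • P.ipA y y :=
        h0.trans (by gcongr)
      have e2 : t • (star a * a) - (2 * t) • (star a * a) + (t ^ 2) • P.ipA y y =
          (t ^ 2) • P.ipA y y - t • (star a * a) := by module
      rw [e2] at h3
      exact sub_nonneg.1 h3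
    have h4 := CStarAlgebra.norm_le_norm_of_nonneg_of_le
      (smul_nonneg ht0.le (star_mul_self_nonneg a)) h2
    rw [norm_smul, norm_smul, CStarRing.norm_star_mul_self, Real.norm_of_nonneg ht0.le,
      Real.norm_of_nonneg (by positivity)] at h4
    nlinarith
  rcases (norm_nonneg (P.ipA y y)).eq_or_lt with h | h
  · have := key (‖P.ipA x x‖ + 1) (by linarith)
    rw [← h] at this ⊢
    simpa using this
  · rw [← div_le_iff₀ h]
    refine le_of_forall_gt_imp_ge_of_dense fun t ht => ?_
    rw [div_le_iff₀ h]
    exact key t ht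

instance : Norm P.V := ⟨fun x => √‖P.ipA x x‖⟩

theorem norm_sq (x : P.V) : ‖x‖ ^ 2 = ‖P.ipA x x‖ := Real.sq_sqrt (norm_nonneg _)

theorem norm_ipA_le (x y : P.V) : ‖P.ipA x y‖ ≤ ‖x‖ * ‖y‖ := by
  refine le_of_sq_le_sq ?_ (mul_nonneg (Real.sqrt_nonneg _) (Real.sqrt_nonneg _))
  rw [mul_pow, norm_sq, norm_sq]
  exact P.ipA_cauchySchwarz x y

theorem seminormedCore : SeminormedSpace.Core ℂ P.V where
  norm_nonneg x := Real.sqrt_nonneg _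
  norm_smul c x := by
    have h0 : 0 ≤ ‖x‖ := Real.sqrt_nonneg _
    have h : ‖c • x‖ ^ 2 = (‖c‖ * ‖x‖) ^ 2 := by
      rw [norm_sq, ipA_smul, ipA_smul_left, norm_smul, norm_smul, norm_star, mul_pow, norm_sq]
      ring
    exact (sq_eq_sq₀ (Real.sqrt_nonneg _) (by positivity)).1 h
  norm_triangle x y := by
    have h0 : 0 ≤ ‖x‖ := Real.sqrt_nonneg _
    have h0' : 0 ≤ ‖y‖ := Real.sqrt_nonneg _
    refine le_of_sq_le_sq ?_ (add_nonneg h0 h0')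
    rw [norm_sq, ipA_add, ipA_add_left, ipA_add_left]
    calc _ ≤ ‖P.ipA x x‖ + ‖P.ipA y x‖ + (‖P.ipA x y‖ + ‖P.ipA y y‖) :=
          (norm_add_le _ _).trans (add_le_add (norm_add_le _ _) (norm_add_le _ _))
      _ ≤ ‖x‖ ^ 2 + ‖y‖ * ‖x‖ + (‖x‖ * ‖y‖ + ‖y‖ ^ 2) := by
          rw [norm_sq, norm_sq]
          gcongr <;> exact P.norm_ipA_le _ _
      _ = _ := by ring

instance : SeminormedAddCommGroup P.V := SeminormedAddCommGroup.ofCore P.seminormedCore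
instance : NormedSpace ℂ P.V where
  norm_smul_le c x := (P.seminormedCore.norm_smul c x).le

/-- The (Hausdorff) completion of a precorrespondence. -/
def Hat : Type u := Completion P.V

instance : NormedAddCommGroup P.Hat := inferInstanceAs (NormedAddCommGroup (Completion P.V))
instance : NormedSpace ℂ P.Hat := inferInstanceAs (NormedSpace ℂ (Completion P.V))
instance : CompleteSpace P.Hat := inferInstanceAs (CompleteSpace (Completion P.V))

/-- The canonical map of a precorrespondence to its completion. -/
def toHat : P.V →ₗ[ℂ] P.Hat where
  toFun x := (x : Completion P.V)
  map_add' x y := Completion.coe_add x y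
  map_smul' c x := Completion.coe_smul c x

theorem norm_toHat (x : P.V) : ‖P.toHat x‖ = ‖x‖ := Completion.norm_coe x

theorem continuous_toHat : Continuous P.toHat := Completion.continuous_coe _

/-- The inner product as a sesquilinear map into `C*(H)`. -/
def ipₗ : P.V →ₗ⋆[ℂ] P.V →ₗ[ℂ] GroupCStar H :=
  LinearMap.mk₂'ₛₗ _ _ P.ipA P.ipA_add_left P.ipA_smul_left P.ipA_add
    (fun c x y => P.ipA_smul c x y)

theorem ipₗ_bound (x y : P.V) : ‖P.ipₗ x y‖ ≤ 1 * ‖x‖ * ‖y‖ := by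
  rw [one_mul]; exact P.norm_ipA_le x y

/-- The right action as a bilinear map into the completion. -/
def rightₗ : P.V →ₗ[ℂ] GroupAlg H →ₗ[ℂ] P.Hat :=
  LinearMap.mk₂ ℂ (fun x f => P.toHat (P.rightAlg f x)) (by simp) (by simp) (by simp) (by simp)

theorem rightₗ_bound (x : P.V) (f : GroupAlg H) : ‖P.rightₗ x f‖ ≤ 1 * ‖x‖ * ‖f‖ := by
  rw [one_mul]
  change ‖P.toHat (P.rightAlg f x)‖ ≤ _
  rw [norm_toHat]
  refine le_of_sq_le_sq ?_ (by positivity)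
  rw [norm_sq, ipA_rightAlg, ipA_rightAlg_left]
  calc _ ≤ ‖star (GroupCStar.ι f)‖ * ‖P.ipA x x‖ * ‖GroupCStar.ι f‖ :=
        (norm_mul_le _ _).trans (by gcongr; exact norm_mul_le _ _)
    _ = (‖x‖ * ‖f‖) ^ 2 := by rw [norm_star, GroupCStar.norm_ι, ← norm_sq]; ring

/-- The `C*(H)`-valued inner product on the completion. -/
def ipHat (x y : P.Hat) : GroupCStar H := ext₂ (fun x y => P.ipₗ x y) x y

/-- The right action of `C*(H)` on the completion. -/
def rmulHat (x : P.Hat) (a : GroupCStar H) : P.Hat := ext₂ (fun x f => P.rightₗ x f) x a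

theorem ipHat_coe (x y : P.V) : P.ipHat (P.toHat x) (P.toHat y) = P.ipA x y :=
  ext₂_coe P.ipₗ P.ipₗ_bound x y

theorem rmulHat_coe (x : P.V) (f : GroupAlg H) :
    P.rmulHat (P.toHat x) (GroupCStar.ι f) = P.toHat (P.rightAlg f x) :=
  ext₂_coe P.rightₗ P.rightₗ_bound x f

theorem continuous_ipHat : Continuous fun p : P.Hat × P.Hat => P.ipHat p.1 p.2 :=
  continuous_ext₂ P.ipₗ P.ipₗ_bound

theorem continuous_rmulHat : Continuous fun p : P.Hat × GroupCStar H => P.rmulHat p.1 p.2 :=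
  continuous_ext₂ P.rightₗ P.rightₗ_bound

theorem hat_induction {Q : P.Hat → Prop} (x : P.Hat) (hc : IsClosed {x | Q x})
    (h : ∀ v : P.V, Q (P.toHat v)) : Q x := Completion.induction_on x hc h

theorem continuous_ipHat' {T : Type*} [TopologicalSpace T] {f g : T → P.Hat} (hf : Continuous f)
    (hg : Continuous g) : Continuous fun t => P.ipHat (f t) (g t) :=
  P.continuous_ipHat.comp (hf.prodMk hg)

theorem continuous_rmulHat' {T : Type*} [TopologicalSpace T] {f : T → P.Hat}
    {g : T → GroupCStar H} (hf : Continuous f) (hg : Continuous g) :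
    Continuous fun t => P.rmulHat (f t) (g t) :=
  P.continuous_rmulHat.comp (hf.prodMk hg)

theorem ipHat_add (x y z : P.Hat) : P.ipHat x (y + z) = P.ipHat x y + P.ipHat x z := by
  refine P.hat_induction (Q := fun x => P.ipHat x (y + z) = P.ipHat x y + P.ipHat x z) x
    (isClosed_eq (P.continuous_ipHat' continuous_id continuous_const)
      ((P.continuous_ipHat' continuous_id continuous_const).add
        (P.continuous_ipHat' continuous_id continuous_const))) fun x => ?_
  refine P.hat_induction (Q := fun y => P.ipHat (P.toHat x) (y + z) =
    P.ipHat (P.toHat x) y + P.ipHat (P.toHat x) z) y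
    (isClosed_eq (P.continuous_ipHat' continuous_const (continuous_id.add continuous_const))
      ((P.continuous_ipHat' continuous_const continuous_id).add continuous_const)) fun y => ?_
  refine P.hat_induction (Q := fun z => P.ipHat (P.toHat x) (P.toHat y + z) =
    P.ipHat (P.toHat x) (P.toHat y) + P.ipHat (P.toHat x) z) z
    (isClosed_eq (P.continuous_ipHat' continuous_const (continuous_const.add continuous_id))
      (continuous_const.add (P.continuous_ipHat' continuous_const continuous_id))) fun z => ?_
  rw [← map_add, ipHat_coe, ipHat_coe, ipHat_coe, ipA_add]

theorem ipHat_smul (c : ℂ) (x y : P.Hat) : P.ipHat x (c • y) = c • P.ipHat x y := by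
  refine P.hat_induction (Q := fun x => P.ipHat x (c • y) = c • P.ipHat x y) x
    (isClosed_eq (P.continuous_ipHat' continuous_id continuous_const)
      ((continuous_const_smul c).comp (P.continuous_ipHat' continuous_id continuous_const)))
    fun x => ?_
  refine P.hat_induction (Q := fun y => P.ipHat (P.toHat x) (c • y) =
    c • P.ipHat (P.toHat x) y) y
    (isClosed_eq (P.continuous_ipHat' continuous_const (continuous_const_smul c))
      ((continuous_const_smul c).comp (P.continuous_ipHat' continuous_const continuous_id)))
    fun y => ?_
  rw [← map_smul, ipHat_coe, ipHat_coe, ipA_smul]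

theorem star_ipHat (x y : P.Hat) : star (P.ipHat x y) = P.ipHat y x := by
  refine P.hat_induction (Q := fun x => star (P.ipHat x y) = P.ipHat y x) x
    (isClosed_eq (GroupCStar.continuous_star'.comp
      (P.continuous_ipHat' continuous_id continuous_const))
      (P.continuous_ipHat' continuous_const continuous_id)) fun x => ?_
  refine P.hat_induction (Q := fun y => star (P.ipHat (P.toHat x) y) = P.ipHat y (P.toHat x)) y
    (isClosed_eq (GroupCStar.continuous_star'.comp
      (P.continuous_ipHat' continuous_const continuous_id))
      (P.continuous_ipHat' continuous_id continuous_const)) fun y => ?_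
  rw [ipHat_coe, ipHat_coe, star_ipA]

theorem ipHat_rmulHat (x y : P.Hat) (a : GroupCStar H) :
    P.ipHat x (P.rmulHat y a) = P.ipHat x y * a := by
  refine P.hat_induction (Q := fun x => P.ipHat x (P.rmulHat y a) = P.ipHat x y * a) x
    (isClosed_eq (P.continuous_ipHat' continuous_id continuous_const)
      ((P.continuous_ipHat' continuous_id continuous_const).mul continuous_const)) fun x => ?_
  refine P.hat_induction (Q := fun y => P.ipHat (P.toHat x) (P.rmulHat y a) =
    P.ipHat (P.toHat x) y * a) y
    (isClosed_eq (P.continuous_ipHat' continuous_const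
      (P.continuous_rmulHat' continuous_id continuous_const))
      ((P.continuous_ipHat' continuous_const continuous_id).mul continuous_const)) fun y => ?_
  refine GroupCStar.induction (P := fun a => P.ipHat (P.toHat x) (P.rmulHat (P.toHat y) a) =
    P.ipHat (P.toHat x) (P.toHat y) * a) a
    (isClosed_eq (P.continuous_ipHat' continuous_const
      (P.continuous_rmulHat' continuous_const continuous_id))
      (continuous_const.mul continuous_id)) fun f => ?_
  rw [rmulHat_coe, ipHat_coe, ipHat_coe, ipA_rightAlg]

theorem ipHat_self_nonneg (x : P.Hat) : 0 ≤ P.ipHat x x := by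
  refine P.hat_induction (Q := fun x => 0 ≤ P.ipHat x x) x
    (isClosed_le continuous_const (P.continuous_ipHat' continuous_id continuous_id)) fun x => ?_
  rw [ipHat_coe]
  exact P.ipA_self_nonneg x

theorem norm_hat (x : P.Hat) : ‖x‖ = √‖P.ipHat x x‖ := by
  refine P.hat_induction (Q := fun x => ‖x‖ = √‖P.ipHat x x‖) x
    (isClosed_eq continuous_norm (P.continuous_ipHat' continuous_id continuous_id).norm.sqrt)
    fun x => ?_
  rw [ipHat_coe, norm_toHat]
  rfl

instance : SMul (GroupCStar H)ᵐᵒᵖ P.Hat := ⟨fun a x => P.rmulHat x (unop a)⟩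

instance : CStarModule (GroupCStar H)ᵐᵒᵖ P.Hat where
  inner x y := op (P.ipHat x y)
  inner_add_right {x y z} := congrArg op (P.ipHat_add x y z)
  inner_self_nonneg {x} := P.ipHat_self_nonneg x
  inner_self {x} := by
    rw [op_eq_zero_iff, ← norm_eq_zero (a := x), norm_hat, Real.sqrt_eq_zero (norm_nonneg _),
      norm_eq_zero]
  inner_op_smul_right {a x y} := congrArg op (P.ipHat_rmulHat x y (unop a))
  inner_smul_right_complex {c x y} := congrArg op (P.ipHat_smul c x y)
  star_inner x y := congrArg op (P.star_ipHat x y)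
  norm_eq_sqrt_norm_inner_self x := P.norm_hat x

theorem norm_left (h : H) (x : P.V) : ‖P.left h x‖ = ‖x‖ := by
  change √‖P.ipA (P.left h x) (P.left h x)‖ = √‖P.ipA x x‖
  rw [ipA, P.ip_left]; rfl

/-- The left action of a group element on the completion. -/
def leftHat (h : H) : P.Hat →L[ℂ] P.Hat :=
  ContinuousLinearMap.completion
    ((P.left h).mkContinuous 1 fun x => by rw [norm_left, one_mul])

theorem leftHat_coe (h : H) (x : P.V) : P.leftHat h (P.toHat x) = P.toHat (P.left h x) :=
  Completion.map_coe (ContinuousLinearMap.uniformContinuous _) x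

/-- The unitary representation of `H` on the completion. -/
def leftRep : H →* (P.Hat →L[ℂ] P.Hat) where
  toFun := P.leftHat
  map_one' := by
    ext x
    refine P.hat_induction (Q := fun x => P.leftHat 1 x = x) x
      (isClosed_eq (P.leftHat 1).continuous continuous_id) fun x => ?_
    rw [leftHat_coe, map_one]; rfl
  map_mul' g h := by
    ext x
    refine P.hat_induction (Q := fun x => P.leftHat (g * h) x = P.leftHat g (P.leftHat h x)) x
      (isClosed_eq (P.leftHat _).continuous
        ((P.leftHat g).continuous.comp (P.leftHat h).continuous)) fun x => ?_
    rw [leftHat_coe, leftHat_coe, leftHat_coe, map_mul]; rfl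

theorem inner_leftRep (h : H) (x y : P.Hat) :
    inner (GroupCStar H)ᵐᵒᵖ (P.leftRep h x) (P.leftRep h y) =
      inner (GroupCStar H)ᵐᵒᵖ x y := by
  refine congrArg op ?_
  change P.ipHat (P.leftHat h x) (P.leftHat h y) = P.ipHat x y
  refine P.hat_induction (Q := fun x => P.ipHat (P.leftHat h x) (P.leftHat h y) = P.ipHat x y) x
    (isClosed_eq (P.continuous_ipHat' (P.leftHat h).continuous continuous_const)
      (P.continuous_ipHat' continuous_id continuous_const)) fun x => ?_
  refine P.hat_induction (Q := fun y => P.ipHat (P.leftHat h (P.toHat x)) (P.leftHat h y) =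
    P.ipHat (P.toHat x) y) y
    (isClosed_eq (P.continuous_ipHat' continuous_const (P.leftHat h).continuous)
      (P.continuous_ipHat' continuous_const continuous_id)) fun y => ?_
  rw [leftHat_coe, leftHat_coe, ipHat_coe, ipHat_coe, ipA, P.ip_left]; rfl

/-- The `C*(H)`-correspondence obtained by completing a precorrespondence over `c_c(H)`. -/
def completion : Correspondence (GroupCStar H) :=
  Correspondence.ofUnitary P.Hat P.leftRep P.inner_leftRep

end PreCorrespondence

end

/-! ### Directed graphs, graph actions and cocycles -/

noncomputable section

open MulOpposite

universe u

/-- A directed graph `E = (E⁰, E¹, r, s)`. -/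
structure DirectedGraph where
  Vertex : Type u
  Edge : Type u
  r : Edge → Vertex
  s : Edge → Vertex

/-- An action of the group `H` on a directed graph by automorphisms. -/
structure GraphAction (H : Type u) [Group H] (E : DirectedGraph.{u}) where
  vertexAction : MulAction H E.Vertex
  edgeAction : MulAction H E.Edge
  r_smul : ∀ (h : H) (e : E.Edge), E.r (h • e) = h • E.r e
  s_smul : ∀ (h : H) (e : E.Edge), E.s (h • e) = h • E.s e

/-- A cocycle for the action of `H` on the graph `E`: a cocycle `κ : H × E¹ → H` for the action on
the edges with `κ(h, e) s(e) = h s(e)`. -/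
structure GraphAction.IsCocycle {H : Type u} [Group H] {E : DirectedGraph.{u}}
    (α : GraphAction H E) (κ : H → E.Edge → H) : Prop where
  map_mul : ∀ g h e, letI := α.edgeAction; κ (g * h) e = κ g (h • e) * κ h e
  map_source : ∀ h e, letI := α.vertexAction; κ h e • E.s e = h • E.s e

/-- The stronger vertex condition of Exel and Pardo: a cocycle such that `κ(h, e)` acts like `h` on
all vertices. -/
structure GraphAction.IsExelPardoCocycle {H : Type u} [Group H] {E : DirectedGraph.{u}}
    (α : GraphAction H E) (κ : H → E.Edge → H) : Prop where
  map_mul : ∀ g h e, letI := α.edgeAction; κ (g * h) e = κ g (h • e) * κ h e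
  map_vertex : ∀ h e (v : E.Vertex), letI := α.vertexAction; κ h e • v = h • v

/-- The directed graph with one vertex and edge set `T`. -/
abbrev oneVertexGraph (T : Type u) : DirectedGraph.{u} where
  Vertex := PUnit
  Edge := T
  r _ := PUnit.unit
  s _ := PUnit.unit

/-- The action of `H` on the graph with one vertex and edge set `T` that fixes the vertex and is the
given action on the edges. -/
def oneVertexAction (H T : Type u) [Group H] [MulAction H T] :
    GraphAction H (oneVertexGraph T) where
  vertexAction :=
    { smul := fun _ v => v
      one_smul := fun _ => rfl
      mul_smul := fun _ _ _ => rfl }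
  edgeAction := inferInstanceAs (MulAction H T)
  r_smul _ _ := rfl
  s_smul _ _ := rfl

/-! ### Precorrespondences spanned by sets -/

section Kernel

variable {H S : Type u} [Group H]

/-- The sesquilinear extension to `span S` of a `c_c(H)`-valued function on `S × S`. -/
def kernelForm (k : S → S → GroupAlg H) : (S →₀ ℂ) →ₗ⋆[ℂ] (S →₀ ℂ) →ₗ[ℂ] GroupAlg H :=
  LinearMap.mk₂'ₛₗ _ _ (fun x y => x.sum fun s c => y.sum fun t d => (star c * d) • k s t)
    (fun x x' y => Finsupp.sum_add_index' (by simp)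
      (by intro s c c'; simp only [star_add, add_mul, add_smul, Finsupp.sum_add]))
    (fun c x y => by
      rw [Finsupp.sum_smul_index (by simp), Finsupp.smul_sum]
      simp only [Finsupp.smul_sum, smul_smul, star_mul', mul_assoc]
      rfl)
    (fun x y y' => by
      rw [← Finsupp.sum_add]
      refine Finsupp.sum_congr fun s _ => Finsupp.sum_add_index' (by simp) ?_
      intro t d d'
      rw [mul_add, add_smul])
    (fun c x y => by
      rw [RingHom.id_apply, Finsupp.smul_sum]
      refine Finsupp.sum_congr fun s _ => ?_
      rw [Finsupp.sum_smul_index (by simp), Finsupp.smul_sum]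
      refine Finsupp.sum_congr fun t _ => ?_
      rw [smul_smul, mul_left_comm])

theorem kernelForm_single (k : S → S → GroupAlg H) (s t : S) (c d : ℂ) :
    kernelForm k (Finsupp.single s c) (Finsupp.single t d) = (star c * d) • k s t := by
  change (Finsupp.single s c).sum (fun s c => (Finsupp.single t d).sum fun t d =>
    (star c * d) • k s t) = _
  rw [Finsupp.sum_single_index (by simp), Finsupp.sum_single_index (by simp)]

/-- Two biadditive expressions on `span S` agree if they agree on basis elements. -/
theorem finsupp_induction₂ {Q : (S →₀ ℂ) → (S →₀ ℂ) → Prop} (h1 : ∀ y, Q 0 y)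
    (h2 : ∀ x x' y, Q x y → Q x' y → Q (x + x') y) (h3 : ∀ x, Q x 0)
    (h4 : ∀ x y y', Q x y → Q x y' → Q x (y + y'))
    (h5 : ∀ s t c d, Q (Finsupp.single s c) (Finsupp.single t d)) (x y : S →₀ ℂ) : Q x y := by
  induction x using Finsupp.induction_linear with
  | zero => exact h1 y
  | add x x' hx hx' => exact h2 _ _ _ hx hx'
  | single s c =>
    induction y using Finsupp.induction_linear with
    | zero => exact h3 _
    | add y y' hy hy' => exact h4 _ _ _ hy hy'
    | single t d => exact h5 _ _ _ _

open Classical in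
/-- The precorrespondence `span S` over `c_c(H)` for a set `S` with commuting left and right actions
of `H` and a `c_c(H)`-valued inner product `k` on `S` of the form `k(s, t) = d(s)⁻¹ d(t)` if
`c(s) = c(t)`, and `k(s, t) = 0` otherwise, for some maps `c` and `d : S → H`. -/
def spanPre (S : Type u) (l : H → S → S) (l_one : ∀ s, l 1 s = s)
    (l_mul : ∀ g h s, l (g * h) s = l g (l h s))
    (r : S → H → S) (r_one : ∀ s, r s 1 = s) (r_mul : ∀ s g h, r s (g * h) = r (r s g) h)
    (l_r : ∀ g s h, l g (r s h) = r (l g s) h) (k : S → S → GroupAlg H)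
    (k_left : ∀ h s t, k (l h s) (l h t) = k s t)
    (k_right : ∀ s t h, k s (r t h) = k s t * GroupAlg.of h)
    (k_form : ∃ (T : Type u) (c : S → T) (d : S → H), ∀ s t,
      k s t = if c s = c t then GroupAlg.of ((d s)⁻¹ * d t) else 0) :
    PreCorrespondence H where
  V := S →₀ ℂ
  ip := kernelForm k
  left :=
    { toFun := fun h => Finsupp.lmapDomain ℂ ℂ (l h)
      map_one' := by ext s; simp [l_one]
      map_mul' := fun g h => by ext s; simp [l_mul] }
  right :=
    { toFun := fun h => Finsupp.lmapDomain ℂ ℂ fun s => r s (unop h)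
      map_one' := by ext s; simp [r_one]
      map_mul' := fun g h => by ext s; simp [r_mul] }
  left_right g h x := by
    change Finsupp.mapDomain _ (Finsupp.mapDomain _ x) = Finsupp.mapDomain _ (Finsupp.mapDomain _ x)
    rw [← Finsupp.mapDomain_comp, ← Finsupp.mapDomain_comp]
    congr 1
    funext s
    exact l_r g s (unop h)
  star_ip x y := by
    obtain ⟨T, c, d, hk⟩ := k_form
    refine finsupp_induction₂ (Q := fun x y => star (kernelForm k x y) = kernelForm k y x)
      (by simp) (fun x x' y h h' => by simp [h, h']) (by simp)
      (fun x y y' h h' => by simp [h, h']) (fun s t a b => ?_) x y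
    rw [kernelForm_single, kernelForm_single, star_smul, star_mul', star_star, mul_comm a, hk, hk]
    congr 1
    by_cases h : c s = c t
    · rw [if_pos h, if_pos h.symm, GroupAlg.star_of, mul_inv_rev, inv_inv]
    · rw [if_neg h, if_neg (Ne.symm h), star_zero]
  ip_self x := by
    obtain ⟨T, c, d, hk⟩ := k_form
    -- `F p x = ∑_{c(s) = p} x(s) d(s)`
    let F : T → (S →₀ ℂ) →ₗ[ℂ] GroupAlg H := fun p =>
      Finsupp.linearCombination ℂ fun s => if c s = p then GroupAlg.of (d s) else 0
    have hF : ∀ p s a, F p (Finsupp.single s a) =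
        a • if c s = p then GroupAlg.of (d s) else 0 := fun p s a =>
      Finsupp.linearCombination_single ℂ a s
    have key : ∀ (J : Finset T) (y z : S →₀ ℂ), (∀ s ∈ y.support, c s ∈ J) →
        kernelForm k y z = ∑ p ∈ J, star (F p y) * F p z := by
      intro J y z
      induction z using Finsupp.induction_linear with
      | zero => intro _; simp
      | add z z' hz hz' => intro h; simp [hz h, hz' h, mul_add, Finset.sum_add_distrib]
      | single t b =>
        intro h
        conv_lhs => rw [← Finsupp.sum_single y]
        conv_rhs => rw [← Finsupp.sum_single y]
        simp only [Finsupp.sum, map_sum, LinearMap.sum_apply, star_sum, Finset.sum_mul]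
        rw [Finset.sum_comm]
        refine Finset.sum_congr rfl fun s hs => ?_
        rw [kernelForm_single, hk]
        simp only [hF]
        rw [Finset.sum_eq_single (c s)]
        · rw [if_pos rfl, star_smul, GroupAlg.star_of, smul_mul_smul_comm]
          congr 1
          by_cases hst : c s = c t
          · rw [if_pos hst, if_pos hst.symm, GroupAlg.of_mul]
          · rw [if_neg hst, if_neg (Ne.symm hst), mul_zero]
        · intro p _ hp
          rw [if_neg (Ne.symm hp)]
          simp
        · intro hn
          exact absurd (h s hs) hn
    let J := x.support.image c
    refine ⟨J.card, fun i => F (J.equivFin.symm i) x, ?_⟩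
    rw [key J x x fun s hs => Finset.mem_image_of_mem c hs, ← Finset.sum_coe_sort]
    exact (Equiv.sum_comp J.equivFin.symm fun p => star (F p x) * F p x).symm
  ip_right x y h := by
    refine finsupp_induction₂ (Q := fun x y => kernelForm k x
      (Finsupp.mapDomain (fun s => r s h) y) = kernelForm k x y * GroupAlg.of h)
      (by simp) (fun x x' y h h' => by simp [h, h', add_mul]) (by simp)
      (fun x y y' h h' => by simp [Finsupp.mapDomain_add, h, h', add_mul])
      (fun s t a b => ?_) x y
    rw [Finsupp.mapDomain_single, kernelForm_single, kernelForm_single, k_right, smul_mul_assoc]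
  ip_left h x y := by
    refine finsupp_induction₂ (Q := fun x y => kernelForm k
      (Finsupp.mapDomain (l h) x) (Finsupp.mapDomain (l h) y) = kernelForm k x y)
      (by simp) (fun x x' y h h' => by simp [Finsupp.mapDomain_add, h, h']) (by simp)
      (fun x y y' h h' => by simp [Finsupp.mapDomain_add, h, h'])
      (fun s t a b => ?_) x y
    rw [Finsupp.mapDomain_single, Finsupp.mapDomain_single, kernelForm_single, kernelForm_single,
      k_left]

end Kernel

end

/-! ### The subgroup correspondence -/

noncomputable section

open MulOpposite
open scoped ENNReal

universe u

section Subgroup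

variable {G : Type u} [Group G] (H : Subgroup G)

open Classical in
/-- The inner product of two group elements: `⟨s, t⟩ = s⁻¹ t` if `sH = tH`, and `0` otherwise. -/
def subgroupKernel (s t : G) : GroupAlg H :=
  if h : (s : G ⧸ H) = (t : G ⧸ H) then GroupAlg.of ⟨s⁻¹ * t, QuotientGroup.eq.1 h⟩ else 0

/-- The precorrespondence `c_c(G) = span G` over `c_c(H)` for Rieffel induction from `H` to the
discrete group `G`, with left action restricted to `H`: `H` acts on `G` by left and right
multiplication, and the inner product of `s, t ∈ G` is `s⁻¹ t` if `sH = tH` and `0` otherwise. -/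
def subgroupPre : PreCorrespondence H :=
  spanPre G (fun h s => (h : G) * s) (by simp) (by simp [mul_assoc])
    (fun s h => s * (h : G)) (by simp) (by simp [mul_assoc]) (by simp [mul_assoc])
    (subgroupKernel H)
    (fun h s t => by
      have e : ((((h : G) * s : G) : G ⧸ H) = (((h : G) * t : G) : G ⧸ H)) ↔
          ((s : G ⧸ H) = (t : G ⧸ H)) := by
        rw [QuotientGroup.eq, QuotientGroup.eq]; simp [mul_assoc]
      unfold subgroupKernel
      by_cases h1 : (s : G ⧸ H) = (t : G ⧸ H)
      · rw [dif_pos h1, dif_pos (e.2 h1)]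
        congr 2
        simp [mul_assoc]
      · rw [dif_neg h1, dif_neg (mt e.1 h1)])
    (fun s t h => by
      have e : ((s : G ⧸ H) = ((t * (h : G) : G) : G ⧸ H)) ↔ ((s : G ⧸ H) = (t : G ⧸ H)) := by
        rw [QuotientGroup.mk_mul_of_mem t h.2]
      unfold subgroupKernel
      by_cases h1 : (s : G ⧸ H) = (t : G ⧸ H)
      · rw [dif_pos h1, dif_pos (e.2 h1), ← GroupAlg.of_mul]
        congr 1
        ext
        simp [mul_assoc]
      · rw [dif_neg h1, dif_neg (mt e.1 h1), zero_mul])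
    ⟨G ⧸ H, fun s => (s : G ⧸ H),
      fun s => ⟨(s : G ⧸ H).out⁻¹ * s, QuotientGroup.eq.1 (QuotientGroup.out_eq' _)⟩,
      fun s t => by
        unfold subgroupKernel
        by_cases h1 : (s : G ⧸ H) = (t : G ⧸ H)
        · rw [dif_pos h1, if_pos h1]
          congr 1
          ext
          simp [h1, mul_assoc]
        · rw [dif_neg h1, if_neg h1]⟩

/-- The `C*(H)`-correspondence `X` of the subgroup `H` of the discrete group `G`: the completion of
`c_c(G)`, i.e. the `C*(G)`-`C*(H)` correspondence of Rieffel induction, with its left action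
restricted to `C*(H)`. -/
def subgroupCorrespondence : Correspondence (GroupCStar H) := (subgroupPre H).completion

/-- The map `κ(h, tH) = η(htH)⁻¹ h η(tH)` of a cross section `η` of `G/H` in `G`. -/
def sectionCocycle (η : G ⧸ H → G) (hη : ∀ x, (η x : G ⧸ H) = x) (h : H) (x : G ⧸ H) : H :=
  ⟨(η (h • x))⁻¹ * (h : G) * η x, by
    rw [mul_assoc]
    refine QuotientGroup.eq.1 ?_
    rw [hη]
    conv_lhs => rw [← hη x]
    rfl⟩

end Subgroup

/-! ### The Exel-Pardo correspondences of a graph with one vertex -/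

section ExelPardo

variable {H T : Type u} [Group H] [MulAction H T]

open Classical in
/-- The precorrespondence `c_c(T × H)` over `c_c(H)` of a cocycle `κ` for the action of `H` on the
graph with one vertex and edge set `T`. -/
def exelPardoPre (κ : H → T → H) (hκ : (oneVertexAction H T).IsCocycle κ) :
    PreCorrespondence H :=
  have hm : ∀ g h e, κ (g * h) e = κ g (h • e) * κ h e := hκ.map_mul
  have h1 : ∀ e, κ 1 e = 1 := fun e => by simpa using hm 1 1 e
  spanPre (T × H)
    -- the left action `h (t, k) = (h t, κ(h, t) k)`
    (fun h x => (h • x.1, κ h x.1 * x.2))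
    (by simp [h1]) (by simp [hm, mul_smul, mul_assoc])
    -- the right action `(t, k) h = (t, k h)`
    (fun x h => (x.1, x.2 * h))
    (by simp) (by simp [mul_assoc]) (by simp [mul_assoc])
    -- the inner product `⟨(t, h), (u, k)⟩ = h⁻¹ k` if `t = u`, and `0` otherwise
    (fun x y => if x.1 = y.1 then GroupAlg.of (x.2⁻¹ * y.2) else 0)
    (fun h x y => by
      by_cases hxy : x.1 = y.1
      · simp [hxy, mul_assoc]
      · simp [hxy])
    (fun x y h => by
      by_cases hxy : x.1 = y.1
      · simp [hxy, ← GroupAlg.of_mul, mul_assoc]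
      · simp [hxy])
    ⟨T, Prod.fst, Prod.snd, fun _ _ => rfl⟩

/-- The Exel-Pardo correspondence `Y^κ` over `C*(H)` of a cocycle `κ` for the action of `H` on the
graph with one vertex and edge set `T`. -/
def exelPardoCorrespondence (κ : H → T → H) (hκ : (oneVertexAction H T).IsCocycle κ) :
    Correspondence (GroupCStar H) := (exelPardoPre κ hκ).completion

/-- The standard right Hilbert `C*(H)`-module `C*(H)^T`, the direct sum of copies of `C*(H)`. -/
abbrev FreeModule (H T : Type u) [Group H] : Type u :=
  WithCStarModule (GroupCStar H)ᵐᵒᵖ (T → (GroupCStar H)ᵐᵒᵖ)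

section

variable [Fintype T] (κ : H → T → H)

theorem star_u_mul_u (h : H) : star (GroupCStar.u h) * GroupCStar.u h = 1 := by
  rw [GroupCStar.u, GroupCStar.star_ι, GroupAlg.star_of, ← GroupCStar.ι_mul, ← GroupAlg.of_mul,
    inv_mul_cancel, GroupAlg.of_one, GroupCStar.ι_one]

/-- The operator `(a_t)_t ↦ (κ(h, h⁻¹t) a_{h⁻¹t})_t` on `C*(H)^T`, i.e. `e_t a ↦ e_{ht} κ(h, t) a`
on the standard basis. -/
def freeOp (h : H) (x : FreeModule H T) : FreeModule H T :=
  (WithCStarModule.equiv _ _).symm fun t =>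
    op (GroupCStar.u (κ h (h⁻¹ • t)) * unop (x (h⁻¹ • t)))

theorem inner_freeOp (h : H) (x y : FreeModule H T) :
    inner (GroupCStar H)ᵐᵒᵖ (freeOp κ h x) (freeOp κ h y) = inner (GroupCStar H)ᵐᵒᵖ x y := by
  rw [WithCStarModule.pi_inner, WithCStarModule.pi_inner]
  refine Fintype.sum_equiv (MulAction.toPerm h⁻¹) _ _ fun t => ?_
  rw [WithCStarModule.inner_def, WithCStarModule.inner_def]
  apply unop_injective
  change star (GroupCStar.u _ * unop (x (h⁻¹ • t))) * (GroupCStar.u _ * unop (y (h⁻¹ • t))) =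
    star (unop (x (h⁻¹ • t))) * unop (y (h⁻¹ • t))
  rw [star_mul, mul_assoc, ← mul_assoc (star (GroupCStar.u _)), star_u_mul_u, one_mul]

/-- `freeOp` as a bounded operator. -/
def freeOpL (h : H) : FreeModule H T →L[ℂ] FreeModule H T :=
  LinearMap.mkContinuous
    { toFun := freeOp κ h
      map_add' := fun x y => by
        ext t
        apply unop_injective
        exact mul_add _ _ _
      map_smul' := fun c x => by
        ext t
        apply unop_injective
        exact mul_smul_comm _ _ _ } 1 fun x => by
    rw [one_mul, CStarModule.norm_eq_sqrt_norm_inner_self (A := (GroupCStar H)ᵐᵒᵖ) x,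
      CStarModule.norm_eq_sqrt_norm_inner_self (A := (GroupCStar H)ᵐᵒᵖ)]
    exact (congrArg (fun a => √‖a‖) (inner_freeOp κ h x x)).le

/-- The unitary representation of `H` on `C*(H)^T` given by a cocycle. -/
def freeRep (hκ : ∀ g h e, κ (g * h) e = κ g (h • e) * κ h e) :
    H →* (FreeModule H T →L[ℂ] FreeModule H T) where
  toFun := freeOpL κ
  map_one' := by
    have h1 : ∀ e, κ 1 e = 1 := fun e => by simpa using hκ 1 1 e
    ext x t
    apply unop_injective
    change GroupCStar.u (κ 1 ((1 : H)⁻¹ • t)) * unop (x ((1 : H)⁻¹ • t)) = unop (x t)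
    rw [h1, inv_one, one_smul, GroupCStar.u, GroupAlg.of_one, GroupCStar.ι_one, one_mul]
  map_mul' g h := by
    ext x t
    apply unop_injective
    change GroupCStar.u (κ (g * h) ((g * h)⁻¹ • t)) * unop (x ((g * h)⁻¹ • t)) =
      GroupCStar.u (κ g (g⁻¹ • t)) *
        (GroupCStar.u (κ h (h⁻¹ • g⁻¹ • t)) * unop (x (h⁻¹ • g⁻¹ • t)))
    rw [hκ, mul_inv_rev, mul_smul, smul_inv_smul, GroupCStar.u, GroupAlg.of_mul,
      GroupCStar.ι_mul, mul_assoc]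
    rfl

end

/-- The correspondence `M` of Exel and Pardo over `C*(H)`, for an action of `H` on the finite graph
with one vertex and edge set `T`: the free Hilbert module `C*(H)^T` with standard basis `(e_t)`
and left action `h (e_t a) = e_{ht} κ(h, t) a`. -/
def exelPardoModule [Finite T] (κ : H → T → H)
    (hκ : (oneVertexAction H T).IsExelPardoCocycle κ) : Correspondence (GroupCStar H) :=
  letI := Fintype.ofFinite T
  Correspondence.ofUnitary (FreeModule H T) (freeRep κ hκ.map_mul) (inner_freeOp κ)

end ExelPardo

/-! ### The Exel-Pardo algebra of a finite graph -/

section ExelPardoAlgebra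

variable {H : Type u} [Group H] {E : DirectedGraph.{u}}

/-- The relations of the Exel-Pardo algebra `O_{H,E}`, for a finite graph `E`, in a unital C*-algebra `B`: `p`, `s` form a
Cuntz-Krieger `E`-family (with `∑ p_v = 1`), `u` is a unitary representation of `H`,
`u_h s_e = s_{he} u_{κ(h, e)}` and `u_h p_v = p_{hv} u_h`. -/
structure ExelPardoFamily (α : GraphAction H E) (κ : H → E.Edge → H) (B : Type*)
    [CStarAlgebra B] where
  p : E.Vertex → B
  s : E.Edge → B
  u : H →* B
  star_p : ∀ v, star (p v) = p v
  p_mul_p : ∀ v, p v * p v = p v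
  p_orthogonal : ∀ v w, v ≠ w → p v * p w = 0
  sum_p : ∑ᶠ v, p v = 1
  star_s_mul_s : ∀ e, star (s e) * s e = p (E.s e)
  sum_s_mul_star_s : ∀ v, (∃ e, E.r e = v) →
    ∑ᶠ e : {e : E.Edge // E.r e = v}, s e * star (s e) = p v
  star_u : ∀ h, star (u h) = u h⁻¹
  u_mul_s : ∀ h e, letI := α.edgeAction; u h * s e = s (h • e) * u (κ h e)
  u_mul_p : ∀ h v, letI := α.vertexAction; u h * p v = p (h • v) * u h

namespace ExelPardoFamily

variable {α : GraphAction H E} {κ : H → E.Edge → H} {B : Type*} [CStarAlgebra B]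

theorem norm_p_le (F : ExelPardoFamily α κ B) (v : E.Vertex) : ‖F.p v‖ ≤ 1 := by
  have h : ‖F.p v‖ = ‖F.p v‖ * ‖F.p v‖ := by
    rw [← CStarRing.norm_star_mul_self, F.star_p, F.p_mul_p]
  nlinarith [norm_nonneg (F.p v), sq_nonneg (‖F.p v‖ - 1)]

theorem norm_s_le (F : ExelPardoFamily α κ B) (e : E.Edge) : ‖F.s e‖ ≤ 1 := by
  have h : ‖F.s e‖ * ‖F.s e‖ ≤ 1 := by
    rw [← CStarRing.norm_star_mul_self, F.star_s_mul_s]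
    exact F.norm_p_le _
  nlinarith [norm_nonneg (F.s e)]

theorem norm_u_le (F : ExelPardoFamily α κ B) (h : H) : ‖F.u h‖ ≤ 1 := by
  have h0 : ‖(1 : B)‖ = ‖(1 : B)‖ * ‖(1 : B)‖ := by
    rw [← CStarRing.norm_star_mul_self, star_one, one_mul]
  have h1 : ‖(1 : B)‖ ≤ 1 := by nlinarith [norm_nonneg (1 : B), sq_nonneg (‖(1 : B)‖ - 1)]
  have h2 : ‖F.u h‖ * ‖F.u h‖ ≤ 1 := by
    rw [← CStarRing.norm_star_mul_self, F.star_u, ← map_mul, inv_mul_cancel, map_one]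
    exact h1
  nlinarith [norm_nonneg (F.u h)]

end ExelPardoFamily

variable (α : GraphAction H E) (κ : H → E.Edge → H)

/-- The Exel-Pardo families in unital C*-algebras. -/
structure ExelPardoRep where
  B : Type u
  [cstar : CStarAlgebra B]
  family : ExelPardoFamily α κ B

attribute [instance] ExelPardoRep.cstar

/-- The product of the target algebras of all Exel-Pardo families. -/
abbrev ExelPardoProduct : Type (u + 1) := lp (fun ρ : ExelPardoRep α κ => ρ.B) ∞

/-- The universal projections. -/
def universalP (v : E.Vertex) : ExelPardoProduct α κ :=
  ⟨fun ρ => ρ.family.p v, memℓp_infty ⟨1, by rintro _ ⟨ρ, rfl⟩; exact ρ.family.norm_p_le v⟩⟩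

/-- The universal partial isometries. -/
def universalS (e : E.Edge) : ExelPardoProduct α κ :=
  ⟨fun ρ => ρ.family.s e, memℓp_infty ⟨1, by rintro _ ⟨ρ, rfl⟩; exact ρ.family.norm_s_le e⟩⟩

/-- The universal unitary representation of `H`. -/
def universalU (h : H) : ExelPardoProduct α κ :=
  ⟨fun ρ => ρ.family.u h, memℓp_infty ⟨1, by rintro _ ⟨ρ, rfl⟩; exact ρ.family.norm_u_le h⟩⟩

/-- The Exel-Pardo algebra as a C*-subalgebra of a product: it is generated by the universal
family, the direct sum of all Exel-Pardo families. Its unit is `u_1 = 1`. -/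
def exelPardoSubalgebra : NonUnitalStarSubalgebra ℂ (ExelPardoProduct α κ) :=
  (NonUnitalStarAlgebra.adjoin ℂ (Set.range (universalP α κ) ∪ Set.range (universalS α κ) ∪
    Set.range (universalU α κ))).topologicalClosure

/-- The Exel-Pardo algebra `O_{H,E}` of an action of `H` on the finite graph `E` with a cocycle:
the universal unital C*-algebra generated by an Exel-Pardo family. -/
def ExelPardoAlgebra [Finite E.Vertex] [Finite E.Edge] : Type (u + 1) := exelPardoSubalgebra α κ

instance [Finite E.Vertex] [Finite E.Edge] : NonUnitalCStarAlgebra (ExelPardoAlgebra α κ) :=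
  NonUnitalStarSubalgebra.nonUnitalCStarAlgebra (exelPardoSubalgebra α κ)
    (h_closed := NonUnitalStarSubalgebra.isClosed_topologicalClosure _)

end ExelPardoAlgebra

end

noncomputable section

open UniformSpace MulOpposite CStarModule
open scoped ENNReal

universe u v

/-! ### C*-subalgebras of products -/

section Products

/-! A cross section splits `G` as a set: `s ↦ (sH, η(sH)⁻¹ s)` is a bijection of `G` onto `G/H × H`.
It turns right multiplication by `H` into right multiplication on the second coordinate. Inside one
coset it turns `s⁻¹ t` into the quotient of the second coordinates. Left multiplication by `h`
becomes `(e, k) ↦ (he, κ(h, e) k)`, which is exactly how `κ` is made. So the two precorrespondences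
are the same up to relabelling, and their completions are isomorphic
(`nonempty_iso_exelPardoCorrespondence`). If `G/H` is finite, `s ↦ t_{sH} (η(sH)⁻¹ s)` has the same
inner products and has dense span in the free module (`nonempty_iso_ofUnitary_freeModule`). Both
maps are extended by `nonempty_iso_of_denseRange`.

Covariant representations pull back along an isomorphism of correspondences, so isomorphic
correspondences have isomorphic Cuntz–Pimsner algebras (`Iso.nonempty_cuntzPimsner_equiv`).

It remains to match covariant representations of the free module with Exel–Pardo families. The
identity is the finite sum of the `θ_{t_e, t_e}`, so `C*(H)` acts by compact operators. The action
is faithful, because on the coset `H` it is conjugate to left multiplication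
(`eq_zero_of_φ_sectionCocycle_eq_zero`). Hence `1` lies in the Katsura ideal, and covariance at `1`
is the Cuntz–Krieger relation `∑ ψ(t_e) ψ(t_e)* = π(1)`. Conversely, isometries `s_e` with `∑ s_e
s_e* = 1` have orthogonal ranges, so `t_e a ↦ s_e π(a)` is a Toeplitz representation, and the same
sum makes it covariant. A covariant representation may live in an algebra without unit; its family
lives in the corner at the projection `π(1)`.

Both universal algebras are closed subalgebras of products over all representations. The two
passages between representations induce *-homomorphisms of these products (`lpPullback`), and it is
enough that these are mutually inverse on generators (`nonempty_starAlgEquiv_of_generators`). -/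

theorem NonUnitalStarAlgHom.continuous_of_cstarAlgebra {Q Q' : Type*} [NonUnitalCStarAlgebra Q]
    [NonUnitalCStarAlgebra Q'] (f : Q →⋆ₙₐ[ℂ] Q') : Continuous f :=
  AddMonoidHomClass.continuous_of_bound f 1 fun x => by
    rw [one_mul]; exact NonUnitalStarAlgHom.norm_apply_le f x

/-- The preimage of a closed *-subalgebra is a closed *-subalgebra, so it is enough to test
generators. -/
theorem NonUnitalStarAlgHom.map_mem_of_mem_closure_adjoin {Q Q' : Type*}
    [NonUnitalCStarAlgebra Q] [NonUnitalCStarAlgebra Q'] (t : Set Q)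
    (t' : NonUnitalStarSubalgebra ℂ Q') (f : Q →⋆ₙₐ[ℂ] Q') (hc : IsClosed (t' : Set Q'))
    (h : ∀ x ∈ t, f x ∈ t') {x : Q}
    (hx : x ∈ (NonUnitalStarAlgebra.adjoin ℂ t).topologicalClosure) : f x ∈ t' := by
  have : (NonUnitalStarAlgebra.adjoin ℂ t).topologicalClosure ≤
      NonUnitalStarSubalgebra.comap f t' :=
    NonUnitalStarSubalgebra.topologicalClosure_minimal _ (NonUnitalStarAlgebra.adjoin_le h)
      (hc.preimage f.continuous_of_cstarAlgebra)
  exact this hx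

/-- The fixed points of a *-homomorphism form a closed *-subalgebra. -/
theorem NonUnitalStarAlgHom.eq_self_of_mem_closure_adjoin {Q : Type*} [NonUnitalCStarAlgebra Q]
    (t : Set Q) (f : Q →⋆ₙₐ[ℂ] Q) (h : ∀ x ∈ t, f x = x) {x : Q}
    (hx : x ∈ (NonUnitalStarAlgebra.adjoin ℂ t).topologicalClosure) : f x = x := by
  have : (NonUnitalStarAlgebra.adjoin ℂ t).topologicalClosure ≤
      NonUnitalStarAlgHom.equalizer f (NonUnitalStarAlgHom.id ℂ Q) :=
    NonUnitalStarSubalgebra.topologicalClosure_minimal _ (NonUnitalStarAlgebra.adjoin_le h)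
      (isClosed_eq f.continuous_of_cstarAlgebra continuous_id)
  exact this hx

/-- Two C*-algebras generated by sets are isomorphic if there are *-homomorphisms between the
ambient algebras that are mutually inverse on the generators. -/
theorem nonempty_starAlgEquiv_of_generators {P P' : Type*} [NonUnitalCStarAlgebra P]
    [NonUnitalCStarAlgebra P'] {S : NonUnitalStarSubalgebra ℂ P}
    {S' : NonUnitalStarSubalgebra ℂ P'} {s : Set P} {s' : Set P'}
    (hS : S = (NonUnitalStarAlgebra.adjoin ℂ s).topologicalClosure)
    (hS' : S' = (NonUnitalStarAlgebra.adjoin ℂ s').topologicalClosure)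
    (Φ : P →⋆ₙₐ[ℂ] P') (Ψ : P' →⋆ₙₐ[ℂ] P) (hΦ : ∀ x ∈ s, Φ x ∈ S') (hΨ : ∀ x ∈ s', Ψ x ∈ S)
    (hΨΦ : ∀ x ∈ s, Ψ (Φ x) = x) (hΦΨ : ∀ x ∈ s', Φ (Ψ x) = x) :
    Nonempty (S ≃⋆ₐ[ℂ] S') := by
  subst hS hS'
  exact ⟨{
    toFun := fun x => ⟨Φ x, Φ.map_mem_of_mem_closure_adjoin s _
      (NonUnitalStarSubalgebra.isClosed_topologicalClosure _) hΦ x.2⟩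
    invFun := fun x => ⟨Ψ x, Ψ.map_mem_of_mem_closure_adjoin s' _
      (NonUnitalStarSubalgebra.isClosed_topologicalClosure _) hΨ x.2⟩
    left_inv := fun x => Subtype.ext ((Ψ.comp Φ).eq_self_of_mem_closure_adjoin s hΨΦ x.2)
    right_inv := fun x => Subtype.ext ((Φ.comp Ψ).eq_self_of_mem_closure_adjoin s' hΦΨ x.2)
    map_mul' := fun x y => Subtype.ext (map_mul Φ x.1 y.1)
    map_add' := fun x y => Subtype.ext (map_add Φ x.1 y.1)
    map_star' := fun x => Subtype.ext (map_star Φ x.1)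
    map_smul' := fun c x => Subtype.ext (map_smul Φ c x.1) }⟩

/-- The *-homomorphism between products of C*-algebras given by a map of the index sets and
*-homomorphisms between the factors. -/
def lpPullback {I J : Type*} {B : I → Type*} {C : J → Type*} [∀ i, NonUnitalCStarAlgebra (B i)]
    [∀ j, NonUnitalCStarAlgebra (C j)] (f : J → I) (θ : ∀ j, B (f j) →⋆ₙₐ[ℂ] C j) :
    lp B ∞ →⋆ₙₐ[ℂ] lp C ∞ where
  toFun x := ⟨fun j => θ j (x (f j)), memℓp_infty ⟨‖x‖, by
    rintro _ ⟨j, rfl⟩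
    exact (NonUnitalStarAlgHom.norm_apply_le (θ j) _).trans
      (lp.norm_apply_le_norm ENNReal.top_ne_zero x (f j))⟩⟩
  map_smul' c x := lp.ext (funext fun j => map_smul (θ j) c (x (f j)))
  map_zero' := lp.ext (funext fun j => map_zero (θ j))
  map_add' x y := lp.ext (funext fun j => map_add (θ j) (x (f j)) (y (f j)))
  map_mul' x y := lp.ext (funext fun j => map_mul (θ j) (x (f j)) (y (f j)))
  map_star' x := lp.ext (funext fun j => map_star (θ j) (x (f j)))

end Products

/-! ### The universal property of the full group C*-algebra -/

namespace GroupCStar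

variable {H : Type*} [Group H]

theorem u_mul (g h : H) : u (g * h) = u g * u h := by
  rw [u, GroupAlg.of_mul, ι_mul]; rfl

theorem u_one : u (1 : H) = 1 := by rw [u, GroupAlg.of_one, ι_one]

theorem star_u (h : H) : star (u h) = u h⁻¹ := by rw [u, star_ι, GroupAlg.star_of]; rfl

/-- The group elements span a dense subspace of `C*(H)`. -/
theorem induction_u {P : GroupCStar H → Prop} (a : GroupCStar H) (hc : IsClosed {a | P a})
    (h0 : P 0) (hadd : ∀ a b, P a → P b → P (a + b)) (hsm : ∀ (c : ℂ) a, P a → P (c • a))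
    (hu : ∀ h, P (u h)) : P a := by
  refine induction a hc fun f => ?_
  induction f using GroupAlg.induction with
  | h0 => exact h0
  | hadd a b ha hb => rw [ι_add]; exact hadd _ _ ha hb
  | hsm c h => rw [ι_smul]; exact hsm c _ (hu h)

section Lift

variable {B : Type*} [CStarAlgebra B] (U : H →* B)

/-- The extension of a representation of `H` in `B` to the group algebra. -/
def liftAlg : GroupAlg H →ₐ[ℂ] B := MonoidAlgebra.lift ℂ B H U

theorem liftAlg_of (h : H) : liftAlg U (GroupAlg.of h) = U h := by
  have := MonoidAlgebra.lift_single (R := ℂ) U h 1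
  rw [one_smul] at this
  exact this

variable (hU : ∀ h, star (U h) = U h⁻¹)
include hU

theorem liftAlg_star (f : GroupAlg H) : liftAlg U (star f) = star (liftAlg U f) := by
  induction f using GroupAlg.induction with
  | h0 => simp
  | hadd a b ha hb => simp [ha, hb]
  | hsm c h => rw [GroupAlg.star_smul_of, map_smul, map_smul, liftAlg_of, liftAlg_of, star_smul, hU]

/-- The norm of `B` pulled back along the *-homomorphism `liftAlg U` is one of the C*-seminorms
whose supremum is the full norm. -/
theorem norm_liftAlg_le (f : GroupAlg H) : ‖liftAlg U f‖ ≤ ‖f‖ :=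
  GroupAlg.le_cnorm
    { (normSeminorm ℂ B).comp (liftAlg U).toLinearMap with
      mul_le' := fun a b => by
        change ‖liftAlg U (a * b)‖ ≤ ‖liftAlg U a‖ * ‖liftAlg U b‖
        rw [map_mul]; exact norm_mul_le _ _
      star_mul_self' := fun a => by
        change ‖liftAlg U (star a * a)‖ = ‖liftAlg U a‖ ^ 2
        rw [map_mul, liftAlg_star U hU, CStarRing.norm_star_mul_self, sq] } f

theorem uniformContinuous_liftAlg : UniformContinuous (liftAlg U) :=
  (LipschitzWith.of_dist_le_mul (K := 1) fun f g => by
    rw [dist_eq_norm, dist_eq_norm, ← map_sub, NNReal.coe_one, one_mul]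
    exact norm_liftAlg_le U hU _).uniformContinuous

omit hU in
/-- The continuous extension of `liftAlg` to `C*(H)`. -/
def liftExt (a : GroupCStar H) : B := Completion.extension (liftAlg U) a

omit hU in
theorem continuous_liftExt : Continuous (liftExt U) :=
  Completion.continuous_extension

theorem liftExt_ι (f : GroupAlg H) : liftExt U (ι f) = liftAlg U f :=
  Completion.extension_coe (uniformContinuous_liftAlg U hU) f

/-- The integrated form of a unitary representation of `H` in a unital C*-algebra. -/
def lift : GroupCStar H →⋆ₙₐ[ℂ] B where
  toFun a := liftExt U a
  map_smul' c a := induction (P := fun a => liftExt U (c • a) =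
      c • liftExt U a) a
    (isClosed_eq ((continuous_liftExt U).comp (continuous_const_smul c))
      ((continuous_const_smul c).comp (continuous_liftExt U)))
    fun f => by rw [← ι_smul, liftExt_ι U hU, liftExt_ι U hU, map_smul]
  map_zero' := by rw [← ι_zero, liftExt_ι U hU, map_zero]
  map_add' a b := induction₂
    (P := fun a b => liftExt U (a + b) =
      liftExt U a + liftExt U b) a b
    (isClosed_eq ((continuous_liftExt U).comp continuous_add)
      (((continuous_liftExt U).comp continuous_fst).add
        ((continuous_liftExt U).comp continuous_snd)))
    fun f g => by
      rw [← ι_add, liftExt_ι U hU, liftExt_ι U hU, liftExt_ι U hU, map_add]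
  map_mul' a b := induction₂
    (P := fun a b => liftExt U (a * b) =
      liftExt U a * liftExt U b) a b
    (isClosed_eq ((continuous_liftExt U).comp continuous_mul)
      (((continuous_liftExt U).comp continuous_fst).mul
        ((continuous_liftExt U).comp continuous_snd)))
    fun f g => by
      rw [← ι_mul, liftExt_ι U hU, liftExt_ι U hU, liftExt_ι U hU, map_mul]
  map_star' a := induction (P := fun a => liftExt U (star a) =
      star (liftExt U a)) a
    (isClosed_eq ((continuous_liftExt U).comp continuous_star')
      (continuous_star.comp (continuous_liftExt U)))
    fun f => by rw [star_ι, liftExt_ι U hU, liftExt_ι U hU, liftAlg_star U hU]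

theorem lift_u (h : H) : lift U hU (u h) = U h :=
  (liftExt_ι U hU _).trans (liftAlg_of U h)

end Lift

end GroupCStar

/-! ### Isomorphisms of correspondences -/

namespace Correspondence

section Unitary

variable {H : Type u} [Group H] {E F : Type u}
  [NormedAddCommGroup E] [NormedSpace ℂ E] [CompleteSpace E] [SMul (GroupCStar H)ᵐᵒᵖ E]
  [CStarModule (GroupCStar H)ᵐᵒᵖ E]
  [NormedAddCommGroup F] [NormedSpace ℂ F] [CompleteSpace F] [SMul (GroupCStar H)ᵐᵒᵖ F]
  [CStarModule (GroupCStar H)ᵐᵒᵖ F]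

theorem continuous_integrated_apply (U : H →* (E →L[ℂ] E))
    (hU : ∀ h x y, inner (GroupCStar H)ᵐᵒᵖ (U h x) (U h y) = inner (GroupCStar H)ᵐᵒᵖ x y)
    (x : E) : Continuous fun a => UnitaryRep.integrated U hU a x :=
  (UnitaryRep.continuous_extend U).clm_apply continuous_const

/-- Both sides are linear and continuous in `a`, and they agree on the group elements, which span a
dense subspace. -/
theorem map_integrated {U : H →* (E →L[ℂ] E)} {V : H →* (F →L[ℂ] F)}
    (hU : ∀ h x y, inner (GroupCStar H)ᵐᵒᵖ (U h x) (U h y) = inner (GroupCStar H)ᵐᵒᵖ x y)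
    (hV : ∀ h x y, inner (GroupCStar H)ᵐᵒᵖ (V h x) (V h y) = inner (GroupCStar H)ᵐᵒᵖ x y)
    (T : E ≃ₗ[ℂ] F) (hc : Continuous T) (hTU : ∀ h x, T (U h x) = V h (T x))
    (a : GroupCStar H) (x : E) :
    T (UnitaryRep.integrated U hU a x) = UnitaryRep.integrated V hV a (T x) := by
  refine GroupCStar.induction_u (P := fun a => T (UnitaryRep.integrated U hU a x) =
    UnitaryRep.integrated V hV a (T x)) a
    (isClosed_eq (hc.comp (continuous_integrated_apply U hU x))
      (continuous_integrated_apply V hV (T x))) (by simp) ?_ ?_ fun h => ?_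
  · intro a b ha hb
    simp [ha, hb]
  · intro c a ha
    simp [ha]
  · rw [UnitaryRep.integrated_u, UnitaryRep.integrated_u, hTU]

/-- An equivariant unitary between Hilbert `C*(H)`-modules with unitary representations of `H` is an
isomorphism of correspondences. -/
def Iso.ofUnitary {U : H →* (E →L[ℂ] E)} {V : H →* (F →L[ℂ] F)}
    (hU : ∀ h x y, inner (GroupCStar H)ᵐᵒᵖ (U h x) (U h y) = inner (GroupCStar H)ᵐᵒᵖ x y)
    (hV : ∀ h x y, inner (GroupCStar H)ᵐᵒᵖ (V h x) (V h y) = inner (GroupCStar H)ᵐᵒᵖ x y)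
    (T : E ≃ₗ[ℂ] F) (hc : Continuous T)
    (hT : ∀ x y, inner (GroupCStar H)ᵐᵒᵖ (T x) (T y) = inner (GroupCStar H)ᵐᵒᵖ x y)
    (hTU : ∀ h x, T (U h x) = V h (T x)) :
    Iso (Correspondence.ofUnitary E U hU) (Correspondence.ofUnitary F V hV) where
  toEquiv := T
  map_ip x y := congrArg unop (hT x y)
  map_left a x := map_integrated hU hV T hc hTU a x
  map_right x a := by
    -- Right linearity is a consequence of preserving inner products: by surjectivity every test
    -- vector is some `T w`, and `⟨T w, T (x a)⟩ = ⟨w, x⟩ a = ⟨T w, (T x) a⟩`.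
    refine ext_ip (X := Correspondence.ofUnitary F V hV) fun z => ?_
    obtain ⟨w, rfl⟩ := T.surjective z
    have key : ∀ x y : E, ip (X := Correspondence.ofUnitary F V hV) (T x) (T y) =
      ip (X := Correspondence.ofUnitary E U hU) x y := fun x y => congrArg unop (hT x y)
    exact (key w (rmul (X := Correspondence.ofUnitary E U hU) x a)).trans
      ((ip_rmul (X := Correspondence.ofUnitary E U hU) w x a).trans
        ((congrArg (· * a) (key w x).symm).trans
          (ip_rmul (X := Correspondence.ofUnitary F V hV) (T w) (T x) a).symm))

end Unitary

/-! ### Isomorphisms out of the completion of a precorrespondence -/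

section Completion

variable {H : Type u} [Group H] (P : PreCorrespondence H) {F : Type u}
  [NormedAddCommGroup F] [NormedSpace ℂ F] [CompleteSpace F] [SMul (GroupCStar H)ᵐᵒᵖ F]
  [CStarModule (GroupCStar H)ᵐᵒᵖ F]

/-- An equivariant map with dense range from a precorrespondence to a correspondence that preserves
the inner products extends to an isomorphism on the completion. -/
theorem nonempty_iso_of_denseRange {V : H →* (F →L[ℂ] F)}
    (hV : ∀ h x y, inner (GroupCStar H)ᵐᵒᵖ (V h x) (V h y) = inner (GroupCStar H)ᵐᵒᵖ x y)
    (f : P.V →ₗ[ℂ] F)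
    (hf : ∀ x y, inner (GroupCStar H)ᵐᵒᵖ (f x) (f y) = op (P.ipA x y))
    (hfV : ∀ h x, f (P.left h x) = V h (f x)) (hd : DenseRange f) :
    Nonempty (Iso P.completion (Correspondence.ofUnitary F V hV)) := by
  have hn : ∀ x, ‖f x‖ = ‖x‖ := fun x => by
    rw [CStarModule.norm_eq_sqrt_norm_inner_self (A := (GroupCStar H)ᵐᵒᵖ), hf]; rfl
  let f' : P.V →L[ℂ] F := f.mkContinuous 1 fun x => by rw [hn, one_mul]
  let T : P.Hat →L[ℂ] F := f'.fromCompletion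
  have hT : ∀ x, T (P.toHat x) = f x := fun x => f'.fromCompletion_apply_coe x
  have hin : ∀ x y, inner (GroupCStar H)ᵐᵒᵖ (T x) (T y) = op (P.ipHat x y) := by
    intro x y
    have ci := CStarModule.continuous_inner (A := (GroupCStar H)ᵐᵒᵖ) (E := F)
    refine P.hat_induction
      (Q := fun x => inner (GroupCStar H)ᵐᵒᵖ (T x) (T y) = op (P.ipHat x y)) x
      (isClosed_eq (ci.comp (T.continuous.prodMk continuous_const))
        (continuous_op.comp (P.continuous_ipHat' continuous_id continuous_const))) fun x => ?_
    refine P.hat_induction (Q := fun y => inner (GroupCStar H)ᵐᵒᵖ (T (P.toHat x)) (T y) =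
        op (P.ipHat (P.toHat x) y)) y
      (isClosed_eq (ci.comp (continuous_const.prodMk T.continuous))
        (continuous_op.comp (P.continuous_ipHat' continuous_const continuous_id))) fun y => ?_
    rw [hT, hT, hf, P.ipHat_coe]
  have hnorm : ∀ x, ‖T x‖ = ‖x‖ := fun x => by
    rw [CStarModule.norm_eq_sqrt_norm_inner_self (A := (GroupCStar H)ᵐᵒᵖ), hin, P.norm_hat]; rfl
  have hiso : Isometry T := AddMonoidHomClass.isometry_of_norm T hnorm
  -- An isometric image of a complete space is closed, and this one contains the dense range of `f`.
  have hsurj : Function.Surjective T := by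
    have hcl : IsClosed (Set.range T) := hiso.isClosedEmbedding.isClosed_range
    have hdT : DenseRange T := hd.mono (by rintro _ ⟨x, rfl⟩; exact ⟨P.toHat x, hT x⟩)
    intro y
    have := hdT y
    rwa [hcl.closure_eq] at this
  let e : P.Hat ≃ₗ[ℂ] F := LinearEquiv.ofBijective T.toLinearMap ⟨hiso.injective, hsurj⟩
  refine ⟨Iso.ofUnitary P.inner_leftRep hV e T.continuous hin fun h x => ?_⟩
  refine P.hat_induction (Q := fun x => T (P.leftHat h x) = V h (T x)) x
    (isClosed_eq (T.continuous.comp (P.leftHat h).continuous)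
      ((V h).continuous.comp T.continuous)) fun x => ?_
  rw [P.leftHat_coe, hT, hT, hfV]

end Completion

/-! ### Transport of Cuntz-Pimsner algebras -/

section Transport

variable {A : Type u} [NonUnitalCStarAlgebra A] [PartialOrder A] [StarOrderedRing A]
  {X Y : Correspondence A}

namespace Iso

theorem norm_map (T : Iso X Y) (x : X) : ‖T.toEquiv x‖ = ‖x‖ := by
  have h : ‖T.toEquiv x‖ ^ 2 = ‖x‖ ^ 2 := by rw [norm_sq, norm_sq, T.map_ip]
  exact (sq_eq_sq₀ (norm_nonneg _) (norm_nonneg _)).1 h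

/-- The inverse isomorphism. -/
def symm (T : Iso X Y) : Iso Y X where
  toEquiv := T.toEquiv.symm
  map_ip x y := by rw [← T.map_ip]; simp
  map_left a x := by
    rw [LinearEquiv.symm_apply_eq, T.map_left]; simp
  map_right x a := by
    rw [LinearEquiv.symm_apply_eq, T.map_right]; simp

/-- The continuous linear equivalence underlying an isomorphism. -/
def toCLE (T : Iso X Y) : X ≃L[ℂ] Y :=
  (LinearIsometryEquiv.mk T.toEquiv T.norm_map).toContinuousLinearEquiv

/-- Conjugation by an isomorphism. -/
def conj (T : Iso X Y) : (X →L[ℂ] X) →L[ℂ] (Y →L[ℂ] Y) :=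
  (T.toCLE.arrowCongr T.toCLE : (X →L[ℂ] X) ≃L[ℂ] (Y →L[ℂ] Y))

theorem conj_apply (T : Iso X Y) (S : X →L[ℂ] X) (y : Y) :
    T.conj S y = T.toEquiv (S (T.toEquiv.symm y)) := rfl

theorem conj_theta (T : Iso X Y) (x y : X) :
    T.conj (theta x y) = theta (T.toEquiv x) (T.toEquiv y) := by
  ext z
  rw [conj_apply]
  change T.toEquiv (rmul x (ip y _)) = rmul (T.toEquiv x) (ip (T.toEquiv y) z)
  rw [T.map_right, ← T.map_ip]
  simp

theorem conj_φ (T : Iso X Y) (a : A) : T.conj (X.φ a) = Y.φ a := by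
  ext z
  rw [conj_apply, T.map_left]
  simp

theorem conj_mem_compacts (T : Iso X Y) {S : X →L[ℂ] X} (hS : S ∈ X.compacts) :
    T.conj S ∈ Y.compacts := by
  have : X.compacts ≤ Y.compacts.comap T.conj.toLinearMap := by
    refine Submodule.topologicalClosure_minimal _ (Submodule.span_le.2 ?_)
      ((Submodule.isClosed_topologicalClosure _).preimage T.conj.continuous)
    rintro _ ⟨x, y, rfl⟩
    change T.conj (theta x y) ∈ Y.compacts
    rw [conj_theta]
    exact (thetaK _ _).2
  exact this hS

/-- Conjugation by `T` carries `X.φ a` to `Y.φ a` and compacts to compacts. Conjugation by the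
inverse shows that whatever acts as zero on `Y` acts as zero on `X`, so the orthogonality condition
transfers too. -/
theorem mem_katsuraIdeal (T : Iso X Y) {a : A} (ha : a ∈ X.katsuraIdeal) :
    a ∈ Y.katsuraIdeal := by
  refine ⟨?_, fun b hb => ha.2 b ?_⟩
  · rw [← T.conj_φ]
    exact T.conj_mem_compacts ha.1
  · rw [← T.symm.conj_φ, hb, map_zero]

/-- Pull-back of covariant representations along an isomorphism. -/
def pullRep (T : Iso X Y) (ρ : Y.CovariantRep) : X.CovariantRep where
  B := ρ.B
  rep :=
    { ψ := ρ.rep.ψ ∘ₗ T.toEquiv.toLinearMap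
      π := ρ.rep.π
      map_left := fun a x => by
        change ρ.rep.ψ (T.toEquiv (X.φ a x)) = _
        rw [T.map_left, ρ.rep.map_left]; rfl
      map_ip := fun x y => by
        change star (ρ.rep.ψ (T.toEquiv x)) * ρ.rep.ψ (T.toEquiv y) = _
        rw [ρ.rep.map_ip, T.map_ip] }
  covariant := by
    obtain ⟨ψ₁, h1, h2⟩ := ρ.covariant
    -- Conjugation by `T` sends `K(X)` into `K(Y)` and `θ_{x,y}` to `θ_{Tx,Ty}`; followed by `ψ₁`,
    -- it is `ψ⁽¹⁾` of the pulled-back representation.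
    refine ⟨ψ₁.comp ((T.conj.comp X.compacts.subtypeL).codRestrict Y.compacts
      fun S => T.conj_mem_compacts S.2), fun x y => ?_, fun a ha => ?_⟩
    · refine Eq.trans ?_ (h1 (T.toEquiv x) (T.toEquiv y))
      exact congrArg ψ₁ (Subtype.ext (T.conj_theta x y))
    · refine Eq.trans ?_ (h2 a (T.mem_katsuraIdeal ha))
      exact congrArg ψ₁ (Subtype.ext (T.conj_φ a))

/-- The *-homomorphism of products of covariant representations given by an isomorphism. -/
def productHom (T : Iso X Y) : X.CovariantProduct →⋆ₙₐ[ℂ] Y.CovariantProduct :=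
  -- The pulled-back representation has the same target algebra as `ρ`, so each coordinate map is an
  -- identity and the values on generators hold by definition.
  lpPullback (B := fun ρ : X.CovariantRep => ρ.B) (C := fun ρ : Y.CovariantRep => ρ.B)
    T.pullRep fun ρ => NonUnitalStarAlgHom.id ℂ ρ.B

theorem productHom_kX (T : Iso X Y) (x : X) : T.productHom (X.kX x) = Y.kX (T.toEquiv x) := rfl

theorem productHom_kA (T : Iso X Y) (a : A) : T.productHom (X.kA a) = Y.kA a := rfl

theorem productHom_mem (T : Iso X Y) {x : X.CovariantProduct}
    (hx : x ∈ Set.range X.kX ∪ Set.range X.kA) :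
    T.productHom x ∈ Y.cuntzPimsnerSubalgebra := by
  refine NonUnitalStarSubalgebra.le_topologicalClosure _
    (NonUnitalStarAlgebra.subset_adjoin ℂ _ ?_)
  rcases hx with ⟨x, rfl⟩ | ⟨a, rfl⟩
  · exact Or.inl ⟨_, (T.productHom_kX x).symm⟩
  · exact Or.inr ⟨_, (T.productHom_kA a).symm⟩

theorem productHom_symm (T : Iso X Y) {x : X.CovariantProduct}
    (hx : x ∈ Set.range X.kX ∪ Set.range X.kA) : T.symm.productHom (T.productHom x) = x := by
  rcases hx with ⟨x, rfl⟩ | ⟨a, rfl⟩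
  · rw [productHom_kX, productHom_kX]
    exact congrArg X.kX (T.toEquiv.symm_apply_apply x)
  · rw [productHom_kA, productHom_kA]

/-- Isomorphic correspondences have isomorphic Cuntz-Pimsner algebras. -/
theorem nonempty_cuntzPimsner_equiv (T : Iso X Y) :
    Nonempty (X.CuntzPimsner ≃⋆ₐ[ℂ] Y.CuntzPimsner) :=
  nonempty_starAlgEquiv_of_generators rfl rfl T.productHom T.symm.productHom
    (fun _ hx => T.productHom_mem hx) (fun _ hx => T.symm.productHom_mem hx)
    (fun _ hx => T.productHom_symm hx) (fun _ hx => T.symm.productHom_symm hx)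

end Iso

end Transport

end Correspondence

/-! ### The standard basis of the free Hilbert module -/

namespace FreeModule

variable {H T : Type u} [Group H]

open Classical in
/-- The element `t_e a` of `C*(H)^T`. -/
def single (e : T) : GroupCStar H →ₗ[ℂ] FreeModule H T where
  toFun a := (WithCStarModule.equiv _ _).symm (Pi.single e (op a))
  map_add' a b := by
    rw [op_add, Pi.single_add]; rfl
  map_smul' c a := by
    rw [op_smul, Pi.single_smul]; rfl

open Classical in
theorem single_apply (e t : T) (a : GroupCStar H) :
    (single e a : FreeModule H T) t = if t = e then op a else 0 := by
  change Pi.single (M := fun _ : T => (GroupCStar H)ᵐᵒᵖ) e (op a) t = _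
  rw [Pi.single_apply]

theorem single_apply_self (e : T) (a : GroupCStar H) :
    (single e a : FreeModule H T) e = op a := by
  classical rw [single_apply, if_pos rfl]

/-- Only the index `t = he` satisfies `h⁻¹ t = e`. This recovers the formula on the standard basis
from the coordinate form of the operator. -/
theorem freeOp_single [MulAction H T] (κ : H → T → H) (h : H) (e : T) (a : GroupCStar H) :
    freeOp κ h (single e a) = single (h • e) (GroupCStar.u (κ h e) * a) := by
  classical
  ext t
  change op (GroupCStar.u (κ h (h⁻¹ • t)) * unop ((single e a : FreeModule H T) (h⁻¹ • t))) = _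
  rw [single_apply, single_apply]
  by_cases ht : t = h • e
  · rw [if_pos ht, if_pos (by rw [ht, inv_smul_smul]), ht, inv_smul_smul]; rfl
  · rw [if_neg ht, if_neg (by rwa [inv_smul_eq_iff])]
    simp

variable [Fintype T]

theorem continuous_apply (t : T) : Continuous fun x : FreeModule H T => x t :=
  AddMonoidHomClass.continuous_of_bound
    ({ toFun := fun x => x t, map_zero' := rfl, map_add' := fun _ _ => rfl } :
      FreeModule H T →+ (GroupCStar H)ᵐᵒᵖ) 1 fun x => by
    rw [one_mul]; exact WithCStarModule.norm_apply_le_norm x t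

theorem continuous_single (e : T) : Continuous (single e : GroupCStar H →ₗ[ℂ] FreeModule H T) := by
  classical
  exact AddMonoidHomClass.continuous_of_bound (single e) 1 fun a => by
    rw [one_mul]; exact (WithCStarModule.norm_single _ _).le

theorem sum_single (x : FreeModule H T) : ∑ e, single e (unop (x e)) = x := by
  classical
  ext t
  have : (∑ e, single e (unop (x e)) : FreeModule H T) t =
      ∑ e, (single e (unop (x e)) : FreeModule H T) t :=
    map_sum ({ toFun := fun x => x t, map_zero' := rfl, map_add' := fun _ _ => rfl } :
      FreeModule H T →+ (GroupCStar H)ᵐᵒᵖ) _ _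
  rw [this, Finset.sum_eq_single t]
  · rw [single_apply_self, op_unop]
  · intro e _ he
    rw [single_apply, if_neg he.symm]
  · simp

theorem inner_eq (x y : FreeModule H T) :
    inner (GroupCStar H)ᵐᵒᵖ x y = op (∑ e, star (unop (x e)) * unop (y e)) := by
  rw [WithCStarModule.pi_inner]
  apply unop_injective
  rw [Finset.unop_sum, unop_op]
  rfl

open Classical in
theorem inner_single (e f : T) (a b : GroupCStar H) :
    inner (GroupCStar H)ᵐᵒᵖ (single e a : FreeModule H T) (single f b) =
      op (if e = f then star a * b else 0) := by
  rw [inner_eq, Finset.sum_eq_single e]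
  · rw [single_apply_self, single_apply]
    split_ifs <;> simp
  · intro t _ ht
    rw [single_apply, if_neg ht]
    simp
  · simp

end FreeModule

/-! ### Models of the subgroup correspondence -/

/-- By sesquilinearity only basis elements matter. This transports inner products along a
relabelling of the spanning set. -/
theorem kernelForm_mapDomain {H S S' : Type u} [Group H] (k : S → S → GroupAlg H)
    (k' : S' → S' → GroupAlg H) (m : S → S') (hm : ∀ s t, k' (m s) (m t) = k s t)
    (x y : S →₀ ℂ) :
    kernelForm k' (Finsupp.mapDomain m x) (Finsupp.mapDomain m y) = kernelForm k x y := by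
  refine finsupp_induction₂ (Q := fun x y => kernelForm k' (Finsupp.mapDomain m x)
    (Finsupp.mapDomain m y) = kernelForm k x y) (by simp)
    (fun x x' y h h' => by simp [Finsupp.mapDomain_add, h, h']) (by simp)
    (fun x y y' h h' => by simp [Finsupp.mapDomain_add, h, h']) (fun s t c d => ?_) x y
  rw [Finsupp.mapDomain_single, Finsupp.mapDomain_single, kernelForm_single, kernelForm_single, hm]

section Subgroup

variable {G : Type u} [Group G] (H : Subgroup G) (η : G ⧸ H → G) (hη : ∀ x, (η x : G ⧸ H) = x)

/-- In the product on the right, `η(hx)` meets its inverse and cancels. -/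
theorem sectionCocycle_mul (g h : H) (x : G ⧸ H) :
    sectionCocycle H η hη (g * h) x =
      sectionCocycle H η hη g (h • x) * sectionCocycle H η hη h x := by
  ext
  change (η ((g * h) • x))⁻¹ * ((g * h : H) : G) * η x =
    ((η (g • h • x))⁻¹ * (g : G) * η (h • x)) * ((η (h • x))⁻¹ * (h : G) * η x)
  rw [mul_smul, Subgroup.coe_mul]
  group

theorem isCocycle_sectionCocycle :
    (oneVertexAction H (G ⧸ H)).IsCocycle (sectionCocycle H η hη) where
  map_mul := sectionCocycle_mul H η hη
  map_source _ _ := rfl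

theorem isExelPardoCocycle_sectionCocycle :
    (oneVertexAction H (G ⧸ H)).IsExelPardoCocycle (sectionCocycle H η hη) where
  map_mul := sectionCocycle_mul H η hη
  map_vertex _ _ _ := rfl

/-- The `H`-component `η(sH)⁻¹ s` of an element of `G` relative to the cross section `η`. -/
def sectionComponent (s : G) : H :=
  ⟨(η s)⁻¹ * s, QuotientGroup.eq.1 (hη s)⟩

/-- Insert `η(sH) η(sH)⁻¹` between `h` and `s` in `η(hsH)⁻¹ h s`. This is why left multiplication on
`G` becomes the left action twisted by `κ`. -/
theorem sectionComponent_mul_left (h : H) (s : G) :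
    sectionComponent H η hη ((h : G) * s) =
      sectionCocycle H η hη h s * sectionComponent H η hη s := by
  ext
  change (η (h • (s : G ⧸ H)))⁻¹ * ((h : G) * s) =
    ((η (h • (s : G ⧸ H)))⁻¹ * (h : G) * η s) * ((η s)⁻¹ * s)
  group

/-- Together with `mk_section_mul`, this exhibits `η(e) k` as the element of `G` with coordinates
`(e, k)`. -/
theorem sectionComponent_section_mul (e : G ⧸ H) (k : H) :
    sectionComponent H η hη (η e * k) = k := by
  have h : ((η e * k : G) : G ⧸ H) = e := by rw [QuotientGroup.mk_mul_of_mem _ k.2, hη]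
  ext
  change (η ((η e * k : G) : G ⧸ H))⁻¹ * (η e * k) = k
  rw [h]
  group

include hη in
theorem mk_section_mul (e : G ⧸ H) (k : H) : ((η e * k : G) : G ⧸ H) = e := by
  rw [QuotientGroup.mk_mul_of_mem _ k.2, hη]

open Classical in
-- Inside one coset `η(sH) = η(tH)`, so the section cancels in the quotient of the two components.
theorem subgroupKernel_eq (s t : G) :
    subgroupKernel H s t = if (s : G ⧸ H) = t then
      GroupAlg.of ((sectionComponent H η hη s)⁻¹ * sectionComponent H η hη t) else 0 := by
  unfold subgroupKernel
  by_cases h : (s : G ⧸ H) = t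
  · rw [dif_pos h, if_pos h]
    congr 1
    ext
    change s⁻¹ * t = ((η s)⁻¹ * s)⁻¹ * ((η t)⁻¹ * t)
    rw [h]
    group
  · rw [dif_neg h, if_neg h]

/-- The coordinate map `s ↦ (sH, η(sH)⁻¹ s)` respects the left actions and the inner products on
spanning sets, and it is onto. -/
theorem nonempty_iso_exelPardoCorrespondence
    (hκ : (oneVertexAction H (G ⧸ H)).IsCocycle (sectionCocycle H η hη)) :
    Nonempty (Correspondence.Iso (subgroupCorrespondence H)
      (exelPardoCorrespondence (sectionCocycle H η hη) hκ)) := by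
  classical
  let Q := exelPardoPre (sectionCocycle H η hη) hκ
  let m : G → (G ⧸ H) × H := fun s => ((s : G ⧸ H), sectionComponent H η hη s)
  have hm : Function.Surjective m := fun ⟨e, k⟩ =>
    ⟨η e * k, Prod.ext (mk_section_mul H η hη e k) (sectionComponent_section_mul H η hη e k)⟩
  let f₀ : (G →₀ ℂ) →ₗ[ℂ] Q.V := Finsupp.lmapDomain ℂ ℂ m
  let f : (subgroupPre H).V →ₗ[ℂ] Q.Hat := Q.toHat ∘ₗ f₀
  refine Correspondence.nonempty_iso_of_denseRange (subgroupPre H) Q.inner_leftRep f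
    (fun x y => ?_) (fun h (x : G →₀ ℂ) => ?_) ?_
  · refine congrArg op ((Q.ipHat_coe _ _).trans (congrArg GroupCStar.ι ?_))
    refine kernelForm_mapDomain (subgroupKernel H) _ m (fun s t => ?_) x y
    rw [subgroupKernel_eq H η hη]
    congr
  · refine Eq.trans (congrArg Q.toHat ?_) (Q.leftHat_coe h _).symm
    refine Finsupp.mapDomain_comp.symm.trans (Eq.trans ?_ Finsupp.mapDomain_comp)
    congr 1
    funext s
    exact Prod.ext rfl (sectionComponent_mul_left H η hη h s)
  · have h1 : Function.Surjective f₀ := Finsupp.mapDomain_surjective hm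
    have h2 : DenseRange Q.toHat := Completion.denseRange_coe
    refine h2.mono ?_
    rintro _ ⟨v, rfl⟩
    obtain ⟨x, rfl⟩ := h1 v
    exact ⟨x, rfl⟩

/-- Send `s` to `t_{sH} u_k` with `k = η(sH)⁻¹ s`. Inner products match because `u_k* u_l =
u_{k⁻¹l}` and different cosets give orthogonal vectors. -/
theorem nonempty_iso_ofUnitary_freeModule [Fintype (G ⧸ H)] :
    Nonempty (Correspondence.Iso (subgroupCorrespondence H)
      (Correspondence.ofUnitary (FreeModule H (G ⧸ H))
        (freeRep (sectionCocycle H η hη) (sectionCocycle_mul H η hη))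
        (inner_freeOp (sectionCocycle H η hη)))) := by
  classical
  let b : G → FreeModule H (G ⧸ H) := fun s =>
    FreeModule.single (s : G ⧸ H) (GroupCStar.u (sectionComponent H η hη s))
  let f : (G →₀ ℂ) →ₗ[ℂ] FreeModule H (G ⧸ H) := Finsupp.linearCombination ℂ b
  have hfs : ∀ s c, f (Finsupp.single s c) = c • b s := fun s c =>
    Finsupp.linearCombination_single ℂ c s
  refine Correspondence.nonempty_iso_of_denseRange (subgroupPre H)
    (inner_freeOp (sectionCocycle H η hη)) f (fun x y => ?_) (fun h x => ?_) ?_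
  · change inner (GroupCStar H)ᵐᵒᵖ (f x) (f y) =
      op (GroupCStar.ι (kernelForm (subgroupKernel H) x y))
    refine finsupp_induction₂ (Q := fun x y => inner (GroupCStar H)ᵐᵒᵖ (f x) (f y) =
      op (GroupCStar.ι (kernelForm (subgroupKernel H) x y)))
      (by simp [GroupCStar.ι_zero]) (fun x x' y h h' => by simp [h, h', GroupCStar.ι_add])
      (by simp [GroupCStar.ι_zero]) (fun x y y' h h' => by simp [h, h', GroupCStar.ι_add])
      (fun s t c d => ?_) x y
    rw [hfs, hfs, CStarModule.inner_smul_left_complex, CStarModule.inner_smul_right_complex,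
      FreeModule.inner_single, kernelForm_single, subgroupKernel_eq H η hη, GroupCStar.ι_smul,
      op_smul, mul_smul]
    congr 3
    split_ifs
    · rw [GroupCStar.star_u, ← GroupCStar.u_mul]; rfl
    · rfl
  · change f (Finsupp.mapDomain (fun s => (h : G) * s) (x : G →₀ ℂ)) =
      freeOpL (sectionCocycle H η hη) h (f x)
    induction (x : G →₀ ℂ) using Finsupp.induction_linear with
    | zero => simp
    | add x y hx hy => rw [Finsupp.mapDomain_add, map_add, map_add, map_add, hx, hy]
    | single s c =>
      rw [Finsupp.mapDomain_single, hfs, hfs, map_smul]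
      congr 1
      refine Eq.trans ?_ (FreeModule.freeOp_single _ _ _ _).symm
      rw [← GroupCStar.u_mul, ← sectionComponent_mul_left]
      rfl
  -- For density: `η(e) k` is sent to `t_e u_k`, the `u_k` span a dense subspace of `C*(H)`, and
  -- every vector is a finite sum of vectors `t_e a`.
  · have h1 : ∀ (e : G ⧸ H) (a : GroupCStar H),
        FreeModule.single e a ∈ (LinearMap.range f).topologicalClosure := by
      intro e a
      refine GroupCStar.induction_u
        (P := fun a => FreeModule.single e a ∈ (LinearMap.range f).topologicalClosure) a
        ((Submodule.isClosed_topologicalClosure _).preimage (FreeModule.continuous_single e))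
        (by rw [map_zero]; exact zero_mem _)
        (fun a b ha hb => by rw [map_add]; exact add_mem ha hb)
        (fun c a ha => by rw [map_smul]; exact Submodule.smul_mem _ c ha) fun k => ?_
      refine Submodule.le_topologicalClosure _ ⟨Finsupp.single (η e * k) 1, ?_⟩
      rw [hfs, one_smul]
      change FreeModule.single ((η e * k : G) : G ⧸ H) _ = _
      rw [mk_section_mul H η hη, sectionComponent_section_mul]
    intro x
    have h2 : x ∈ (LinearMap.range f).topologicalClosure := by
      rw [← FreeModule.sum_single x]
      exact sum_mem fun e _ => h1 e _
    exact h2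

end Subgroup

/-! ### Corners and Cuntz families -/

section Corner

variable {B : Type u} [NonUnitalCStarAlgebra B]

/-- The corner `e B e` of a C*-algebra at a projection `e`. -/
def corner (e : B) (he : star e = e) : NonUnitalStarSubalgebra ℂ B where
  carrier := {b | e * b = b ∧ b * e = b}
  add_mem' := fun {a b} ha hb => ⟨by rw [mul_add, ha.1, hb.1], by rw [add_mul, ha.2, hb.2]⟩
  zero_mem' := ⟨mul_zero _, zero_mul _⟩
  mul_mem' := fun {a b} ha hb => ⟨by rw [← mul_assoc, ha.1], by rw [mul_assoc, hb.2]⟩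
  smul_mem' := fun c {b} hb => ⟨by rw [mul_smul_comm, hb.1], by rw [smul_mul_assoc, hb.2]⟩
  star_mem' := fun {b} hb =>
    ⟨by rw [← he, ← star_mul, hb.2], by
      have := congrArg star hb.1
      rwa [star_mul, he] at this⟩

theorem isClosed_corner (e : B) (he : star e = e) : IsClosed (corner e he : Set B) :=
  (isClosed_eq (continuous_const.mul continuous_id) continuous_id).inter
    (isClosed_eq (continuous_id.mul continuous_const) continuous_id)

/-- The corner of a C*-algebra at a projection is a unital C*-algebra. -/
abbrev cornerCStarAlgebra (e : B) (he : star e = e) (he' : e * e = e) :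
    CStarAlgebra (corner e he) :=
  letI : NonUnitalCStarAlgebra (corner e he) :=
    NonUnitalStarSubalgebra.nonUnitalCStarAlgebra (corner e he) (h_closed := isClosed_corner e he)
  letI : NormedRing (corner e he) :=
    { (inferInstance : NonUnitalNormedRing (corner e he)) with
      -- The unit of the corner is the projection `e`; `B` itself need not have a unit.
      one := ⟨e, he', he'⟩
      one_mul := fun b => Subtype.ext b.2.1
      mul_one := fun b => Subtype.ext b.2.2 }
  letI alg : Algebra ℂ (corner e he) := Algebra.ofModule smul_mul_assoc mul_smul_comm
  letI : NormedAlgebra ℂ (corner e he) := { norm_smul_le := norm_smul_le }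
  { (inferInstance : NonUnitalCStarAlgebra (corner e he)),
    (inferInstance : NormedRing (corner e he)),
    (inferInstance : NormedAlgebra ℂ (corner e he)) with }

end Corner

section Cuntz

variable {B : Type*} [CStarAlgebra B] {T : Type*} [Fintype T]

/-- Isometries whose range projections sum to `1` have orthogonal ranges. -/
theorem star_mul_eq_zero_of_sum_mul_star (s : T → B) (h1 : ∀ e, star (s e) * s e = 1)
    (h2 : ∑ e, s e * star (s e) = 1) {e f : T} (hef : e ≠ f) : star (s e) * s f = 0 := by
  classical
  let _ : PartialOrder B := CStarAlgebra.spectralOrder B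
  have _ : StarOrderedRing B := CStarAlgebra.spectralOrderedRing B
  -- Insert `1 = ∑ s_g s_g*` into `s_e* s_e = 1`.
  have h3 : ∑ g, (star (s e) * s g) * star (star (s e) * s g) = 1 := by
    have : ∑ g, (star (s e) * s g) * star (star (s e) * s g) =
        star (s e) * (∑ g, s g * star (s g)) * s e := by
      rw [Finset.mul_sum, Finset.sum_mul]
      exact Finset.sum_congr rfl fun g _ => by simp [mul_assoc]
    rw [this, h2, mul_one, h1]
  -- The summand `g = e` is already `1`, so the remaining positive summands add up to zero and each
  -- of them vanishes.
  rw [← Finset.add_sum_erase _ _ (Finset.mem_univ e), h1, star_one, mul_one, add_eq_left] at h3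
  have h4 := (Finset.sum_eq_zero_iff_of_nonneg fun g _ => mul_star_self_nonneg _).1 h3 f
    (Finset.mem_erase.2 ⟨hef.symm, Finset.mem_univ f⟩)
  exact CStarRing.mul_star_self_eq_zero_iff _ |>.1 h4

end Cuntz

/-! ### Right linearity of Toeplitz representations and of the universal one -/

namespace Correspondence

section

variable {A : Type u} [NonUnitalCStarAlgebra A] [PartialOrder A] [StarOrderedRing A]
  {X : Correspondence A}

/-- Right linearity is forced by compatibility with inner products. The difference `d = ψ(xa) -
ψ(x)π(a)` satisfies `ψ(z)* d = 0` for all `z`; expanding the left factor gives `d* d = 0`, hence `d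
= 0`. -/
theorem ToeplitzRep.map_right {B : Type v} [NonUnitalCStarAlgebra B] (ρ : X.ToeplitzRep B)
    (x : X) (a : A) : ρ.ψ (rmul x a) = ρ.ψ x * ρ.π a := by
  have h : ∀ z, star (ρ.ψ z) * (ρ.ψ (rmul x a) - ρ.ψ x * ρ.π a) = 0 := fun z => by
    rw [mul_sub, ρ.map_ip, ← mul_assoc, ρ.map_ip, ip_rmul, map_mul, sub_self]
  rw [← sub_eq_zero, ← CStarRing.star_mul_self_eq_zero_iff]
  conv_lhs => rw [star_sub, star_mul, sub_mul, mul_assoc, h, h, mul_zero, sub_zero]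

theorem kA_add (a b : A) : X.kA (a + b) = X.kA a + X.kA b :=
  lp.ext (funext fun ρ => map_add ρ.rep.π a b)

theorem kA_smul (c : ℂ) (a : A) : X.kA (c • a) = c • X.kA a :=
  lp.ext (funext fun ρ => map_smul ρ.rep.π c a)

theorem kX_add (x y : X) : X.kX (x + y) = X.kX x + X.kX y :=
  lp.ext (funext fun ρ => map_add ρ.rep.ψ x y)

theorem kA_zero : X.kA 0 = 0 := lp.ext (funext fun ρ => map_zero ρ.rep.π)

theorem kX_rmul (x : X) (a : A) : X.kX (rmul x a) = X.kX x * X.kA a :=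
  lp.ext (funext fun ρ => ρ.rep.map_right x a)

theorem continuous_kA : Continuous X.kA :=
  AddMonoidHomClass.continuous_of_bound
    ({ toFun := X.kA, map_zero' := kA_zero, map_add' := kA_add } : A →+ X.CovariantProduct) 1
    fun a => by
      rw [one_mul]
      exact lp.norm_le_of_forall_le (norm_nonneg a) fun ρ => ρ.rep.norm_π_le a

end

end Correspondence

/-! ### The correspondence of a cocycle on a finite set -/

section FreeCorrespondence

open Correspondence

variable {H T : Type u} [Group H] [MulAction H T] [Fintype T] (κ : H → T → H)
  (hκ : ∀ g h e, κ (g * h) e = κ g (h • e) * κ h e)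

/-- The correspondence `C*(H)^T` of a cocycle for an action of `H` on the finite set `T`. -/
def freeCorrespondence : Correspondence (GroupCStar H) :=
  Correspondence.ofUnitary (FreeModule H T) (freeRep κ hκ) (inner_freeOp κ)

namespace freeCorrespondence

/-- The element `t_e a`. -/
def basis (e : T) (a : GroupCStar H) : freeCorrespondence κ hκ :=
  (FreeModule.single e a : FreeModule H T)

open Classical in
theorem ip_basis (e f : T) (a b : GroupCStar H) :
    ip (basis κ hκ e a) (basis κ hκ f b) = if e = f then star a * b else 0 :=
  congrArg unop (FreeModule.inner_single e f a b)

theorem sum_basis_apply (x : freeCorrespondence κ hκ) :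
    ∑ e, basis κ hκ e (unop ((x : FreeModule H T) e)) = x :=
  FreeModule.sum_single (x : FreeModule H T)

theorem basis_add (e : T) (a b : GroupCStar H) :
    basis κ hκ e (a + b) = basis κ hκ e a + basis κ hκ e b :=
  map_add (FreeModule.single e) a b

/-- A vector is determined by its inner products, and pairing with `t_e c` reads off only the
coefficient at `e`. -/
theorem rmul_basis (e : T) (a b : GroupCStar H) :
    rmul (basis κ hκ e a) b = basis κ hκ e (a * b) := by
  classical
  have ip_sum : ∀ z x : freeCorrespondence κ hκ,
      ip z x = ∑ f, star (unop ((z : FreeModule H T) f)) * unop ((x : FreeModule H T) f) :=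
    fun z x => congrArg unop (FreeModule.inner_eq (z : FreeModule H T) (x : FreeModule H T))
  have ip_right : ∀ (z : freeCorrespondence κ hκ) (c : GroupCStar H),
      ip z (basis κ hκ e c) = star (unop ((z : FreeModule H T) e)) * c := by
    intro z c
    rw [ip_sum, Finset.sum_eq_single e]
    · exact congrArg (fun d => star (unop ((z : FreeModule H T) e)) * unop d)
        (FreeModule.single_apply_self e c)
    · intro f _ hf
      refine (congrArg (fun d => star (unop ((z : FreeModule H T) f)) * unop d)
        (FreeModule.single_apply e f c)).trans ?_
      rw [if_neg hf, unop_zero, mul_zero]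
    · simp
  refine ext_ip fun z => ?_
  rw [ip_rmul, ip_right, ip_right, mul_assoc]

theorem φ_u_basis (h : H) (e : T) (a : GroupCStar H) :
    (freeCorrespondence κ hκ).φ (GroupCStar.u h) (basis κ hκ e a) =
      basis κ hκ (h • e) (GroupCStar.u (κ h e) * a) := by
  have h1 : (freeCorrespondence κ hκ).φ (GroupCStar.u h) = freeRep κ hκ h :=
    UnitaryRep.integrated_u (freeRep κ hκ) (inner_freeOp κ) h
  rw [h1]
  exact FreeModule.freeOp_single κ h e a

/-- The unit of `C*(H)` is the group element `u 1`, which a representation sends to the identity. -/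
theorem φ_one : (freeCorrespondence κ hκ).φ 1 = ContinuousLinearMap.id ℂ _ := by
  have h1 : (freeCorrespondence κ hκ).φ (GroupCStar.u 1) = freeRep κ hκ 1 :=
    UnitaryRep.integrated_u (freeRep κ hκ) (inner_freeOp κ) 1
  rw [← GroupCStar.u_one, h1, map_one]
  rfl

theorem continuous_φ_apply (x : freeCorrespondence κ hκ) :
    Continuous fun a => (freeCorrespondence κ hκ).φ a x :=
  continuous_integrated_apply (freeRep κ hκ) (inner_freeOp κ) x

theorem continuous_basis (e : T) : Continuous (basis κ hκ e) := FreeModule.continuous_single e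

theorem ip_basis_one (e : T) (x : freeCorrespondence κ hκ) :
    ip (basis κ hκ e 1) x = unop ((x : FreeModule H T) e) := by
  classical
  conv_lhs => rw [← sum_basis_apply κ hκ x]
  have ip_sum : ∀ (s : Finset T) (y : T → freeCorrespondence κ hκ),
      ip (basis κ hκ e 1) (∑ f ∈ s, y f) = ∑ f ∈ s, ip (basis κ hκ e 1) (y f) := fun s y =>
    map_sum (AddMonoidHom.mk' (fun y => ip (basis κ hκ e 1) y) (ip_add _)) _ _
  rw [ip_sum, Finset.sum_eq_single e]
  · rw [ip_basis, if_pos rfl, star_one, one_mul]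
  · intro f _ hf
    rw [ip_basis, if_neg hf.symm]
  · simp

/-- Reconstruction from the standard basis. -/
theorem sum_basis (x : freeCorrespondence κ hκ) :
    ∑ e, rmul (basis κ hκ e 1) (ip (basis κ hκ e 1) x) = x := by
  conv_rhs => rw [← sum_basis_apply κ hκ x]
  exact Finset.sum_congr rfl fun e _ => by rw [rmul_basis, one_mul, ip_basis_one]

/-- The identity is a sum of rank-one operators. -/
theorem sum_thetaK :
    ((∑ e, thetaK (basis κ hκ e 1) (basis κ hκ e 1) : (freeCorrespondence κ hκ).compacts) :
      freeCorrespondence κ hκ →L[ℂ] freeCorrespondence κ hκ) = (freeCorrespondence κ hκ).φ 1 := by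
  rw [φ_one, AddSubmonoidClass.coe_finsetSum]
  ext x
  rw [sum_apply]
  exact sum_basis κ hκ x

/-- The finite basis makes the identity operator compact, and faithfulness makes the orthogonality
condition trivial. -/
theorem one_mem_katsuraIdeal (hφ : ∀ b, (freeCorrespondence κ hκ).φ b = 0 → b = 0) :
    (1 : GroupCStar H) ∈ (freeCorrespondence κ hκ).katsuraIdeal :=
  ⟨by rw [← sum_thetaK]; exact Subtype.property _, fun b hb => by rw [hφ b hb, mul_zero]⟩

/-- The Cuntz-Pimsner algebra is generated by the standard basis and the group elements. -/
theorem cuntzPimsnerSubalgebra_eq :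
    (freeCorrespondence κ hκ).cuntzPimsnerSubalgebra = (NonUnitalStarAlgebra.adjoin ℂ
      (Set.range (fun e => (freeCorrespondence κ hκ).kX (basis κ hκ e 1)) ∪
        Set.range fun h => (freeCorrespondence κ hκ).kA (GroupCStar.u h))).topologicalClosure := by
  refine le_antisymm ?_ (NonUnitalStarSubalgebra.topologicalClosure_mono
    (NonUnitalStarAlgebra.adjoin_mono ?_))
  · set S := (NonUnitalStarAlgebra.adjoin ℂ
      (Set.range (fun e => (freeCorrespondence κ hκ).kX (basis κ hκ e 1)) ∪
        Set.range fun h => (freeCorrespondence κ hκ).kA (GroupCStar.u h))).topologicalClosure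
      with hS
    have hc : IsClosed (S : Set (freeCorrespondence κ hκ).CovariantProduct) :=
      NonUnitalStarSubalgebra.isClosed_topologicalClosure _
    have hsub := (NonUnitalStarAlgebra.subset_adjoin ℂ _).trans
      (NonUnitalStarSubalgebra.le_topologicalClosure (NonUnitalStarAlgebra.adjoin ℂ
      (Set.range (fun e => (freeCorrespondence κ hκ).kX (basis κ hκ e 1)) ∪
        Set.range fun h => (freeCorrespondence κ hκ).kA (GroupCStar.u h))))
    -- The group elements span a dense subspace of `C*(H)`, so they account for all of `k_A`.
    have hA : ∀ a, (freeCorrespondence κ hκ).kA a ∈ S := fun a =>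
      GroupCStar.induction_u (P := fun a => (freeCorrespondence κ hκ).kA a ∈ S) a
        (hc.preimage continuous_kA) (by rw [kA_zero]; exact zero_mem S)
        (fun a b ha hb => by rw [kA_add]; exact add_mem ha hb)
        (fun c a ha => by rw [kA_smul]; exact SMulMemClass.smul_mem c ha)
        fun h => hsub (Or.inr ⟨h, rfl⟩)
    refine NonUnitalStarSubalgebra.topologicalClosure_minimal _
      (NonUnitalStarAlgebra.adjoin_le ?_) hc
    rintro _ (⟨x, rfl⟩ | ⟨a, rfl⟩)
    -- By reconstruction and right linearity, `k_X(x) = ∑ k_X(t_e) k_A(⟨t_e, x⟩)`, a finite sum.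
    · have hx : (freeCorrespondence κ hκ).kX x =
          ∑ e, (freeCorrespondence κ hκ).kX (rmul (basis κ hκ e 1) (ip (basis κ hκ e 1) x)) := by
        conv_lhs => rw [← sum_basis κ hκ x]
        exact map_sum (AddMonoidHom.mk' (freeCorrespondence κ hκ).kX kX_add) _ _
      rw [hx]
      refine sum_mem fun e _ => ?_
      rw [kX_rmul]
      exact mul_mem (hsub (Or.inl ⟨e, rfl⟩)) (hA _)
    · exact hA a
  · exact Set.union_subset_union (by rintro _ ⟨e, rfl⟩; exact ⟨_, rfl⟩)
      (by rintro _ ⟨h, rfl⟩; exact ⟨_, rfl⟩)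

end freeCorrespondence

end FreeCorrespondence

/-! ### The Toeplitz representation of an Exel–Pardo family -/

section Families

open Correspondence

variable {H T : Type u} [Group H] [MulAction H T] {κ : H → T → H}

/-- Every edge has the only vertex as its range, so the Cuntz–Krieger sum runs over all edges. -/
theorem finsum_oneVertexGraph [Fintype T] {B : Type*} [AddCommMonoid B] (v : (oneVertexGraph T).Vertex)
    (g : T → B) : ∑ᶠ e : {e : (oneVertexGraph T).Edge // (oneVertexGraph T).r e = v}, g e =
      ∑ e, g e := by
  rw [← finsum_eq_sum_of_fintype]
  exact finsum_comp_equiv (Equiv.subtypeUnivEquiv (p := fun e => (oneVertexGraph T).r e = v)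
    fun _ => rfl)

namespace ExelPardoFamily

variable {B : Type v} [CStarAlgebra B] (F : ExelPardoFamily (oneVertexAction H T) κ B)

theorem p_eq_one (v : PUnit) : F.p v = 1 := by
  rw [← F.sum_p]
  exact (finsum_unique (α := PUnit) F.p).symm

theorem star_mul_self (e : T) : star (F.s e) * F.s e = 1 := by
  rw [← F.p_eq_one PUnit.unit]
  exact F.star_s_mul_s e

/-- The representation of `C*(H)` of an Exel-Pardo family. -/
def π : GroupCStar H →⋆ₙₐ[ℂ] B := GroupCStar.lift F.u F.star_u

theorem π_u (h : H) : F.π (GroupCStar.u h) = F.u h := GroupCStar.lift_u F.u F.star_u h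

theorem continuous_π : Continuous F.π := NonUnitalStarAlgHom.continuous_of_cstarAlgebra _

variable [Fintype T]

/-- The Cuntz–Krieger relation is imposed only at vertices that receive an edge; hence the
nonemptiness of `T`. -/
theorem sum_mul_star [Nonempty T] : ∑ e : T, F.s e * star (F.s e) = 1 := by
  rw [← finsum_oneVertexGraph PUnit.unit fun e => F.s e * star (F.s e), ← F.p_eq_one PUnit.unit]
  exact F.sum_s_mul_star_s PUnit.unit ⟨Classical.arbitrary T, rfl⟩

open Classical in
-- Orthogonality of the ranges is not among the defining relations; it follows from the range
-- projections summing to `1`.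
theorem star_s_mul_s_eq [Nonempty T] (e f : T) : star (F.s e) * F.s f = if e = f then 1 else 0 := by
  split_ifs with h
  · rw [h, F.star_mul_self]
  · exact star_mul_eq_zero_of_sum_mul_star F.s F.star_mul_self F.sum_mul_star h

variable (hκ : ∀ g h e, κ (g * h) e = κ g (h • e) * κ h e)

/-- The linear map `t_e a ↦ s_e a` of an Exel-Pardo family. -/
def ψ : freeCorrespondence κ hκ →ₗ[ℂ] B where
  toFun x := ∑ e : T, F.s e * F.π (unop ((x : FreeModule H T) e))
  map_add' x y := by
    rw [← Finset.sum_add_distrib]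
    refine Finset.sum_congr rfl fun e _ => ?_
    rw [← mul_add, ← map_add]
    rfl
  map_smul' c x := by
    rw [RingHom.id_apply, Finset.smul_sum]
    refine Finset.sum_congr rfl fun e _ => ?_
    rw [← mul_smul_comm, ← map_smul]
    rfl

theorem ψ_apply (x : freeCorrespondence κ hκ) :
    F.ψ hκ x = ∑ e : T, F.s e * F.π (unop ((x : FreeModule H T) e)) := rfl

theorem continuous_ψ : Continuous (F.ψ hκ) := by
  refine continuous_finsetSum _ fun e _ => continuous_const.mul (F.continuous_π.comp ?_)
  exact continuous_unop.comp (FreeModule.continuous_apply e)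

theorem ψ_basis (e : T) (a : GroupCStar H) :
    F.ψ hκ (freeCorrespondence.basis κ hκ e a) = F.s e * F.π a := by
  classical
  rw [ψ_apply, Finset.sum_eq_single e]
  · exact congrArg (fun b => F.s e * F.π (unop b)) (FreeModule.single_apply_self e a)
  · intro f _ hf
    refine (congrArg (fun b => F.s f * F.π (unop b)) (FreeModule.single_apply e f a)).trans ?_
    rw [if_neg hf, unop_zero, map_zero, mul_zero]
  · simp

/-- By linearity and continuity it suffices to take `a = u_h` and `x = t_e b`, where this is the
relation `u_h s_e = s_{he} u_{κ(h,e)}`. -/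
theorem ψ_φ (a : GroupCStar H) (x : freeCorrespondence κ hκ) :
    F.ψ hκ ((freeCorrespondence κ hκ).φ a x) = F.π a * F.ψ hκ x := by
  refine GroupCStar.induction_u (P := fun a =>
    F.ψ hκ ((freeCorrespondence κ hκ).φ a x) = F.π a * F.ψ hκ x) a
    (isClosed_eq ((F.continuous_ψ hκ).comp (freeCorrespondence.continuous_φ_apply κ hκ x))
      (F.continuous_π.mul continuous_const)) (by simp) (fun a b ha hb => ?_)
    (fun c a ha => ?_) fun h => ?_
  · rw [map_add, add_apply, map_add, ha, hb, map_add, add_mul]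
  · rw [map_smul, smul_apply, map_smul, ha, map_smul, smul_mul_assoc]
  · rw [← freeCorrespondence.sum_basis_apply κ hκ x]
    simp only [map_sum, Finset.mul_sum]
    refine Finset.sum_congr rfl fun e _ => ?_
    rw [freeCorrespondence.φ_u_basis, ψ_basis, ψ_basis, map_mul, π_u, π_u, ← mul_assoc, ← mul_assoc]
    exact congrArg (· * _) (F.u_mul_s h e).symm

/-- Expand both sums: the cross terms vanish because the ranges are orthogonal, and the diagonal
terms use that each `s_e` is an isometry. -/
theorem star_ψ_mul_ψ [Nonempty T] (x y : freeCorrespondence κ hκ) :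
    star (F.ψ hκ x) * F.ψ hκ y = F.π (ip x y) := by
  classical
  have h : ip x y = ∑ e, star (unop ((x : FreeModule H T) e)) * unop ((y : FreeModule H T) e) :=
    congrArg unop (FreeModule.inner_eq (x : FreeModule H T) (y : FreeModule H T))
  rw [h, ψ_apply, ψ_apply, star_sum, Finset.sum_mul, map_sum]
  refine Finset.sum_congr rfl fun e _ => ?_
  rw [Finset.mul_sum, Finset.sum_eq_single e]
  · rw [star_mul, mul_assoc, ← mul_assoc (star (F.s e)), F.star_mul_self, one_mul, map_mul,
      map_star]
  · intro f _ hf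
    rw [star_mul, mul_assoc, ← mul_assoc (star (F.s e)), F.star_s_mul_s_eq, if_neg hf.symm,
      zero_mul, mul_zero]
  · simp

/-- The Toeplitz representation of an Exel-Pardo family. -/
def toeplitzRep [Nonempty T] : (freeCorrespondence κ hκ).ToeplitzRep B where
  ψ := F.ψ hκ
  π := F.π
  map_left := F.ψ_φ hκ
  map_ip := F.star_ψ_mul_ψ hκ

end ExelPardoFamily

/-! ### The map `ψ⁽¹⁾` in terms of the finite basis -/

namespace freeCorrespondence

variable [Fintype T] (hκ : ∀ g h e, κ (g * h) e = κ g (h • e) * κ h e)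
  {B : Type v} [NonUnitalCStarAlgebra B] (ρ : (freeCorrespondence κ hκ).ToeplitzRep B)

/-- The map `S ↦ ∑ ψ(S t_e) ψ(t_e)*`, which restricts to `ψ⁽¹⁾` on the compact operators. -/
def psiOne : (freeCorrespondence κ hκ →L[ℂ] freeCorrespondence κ hκ) →L[ℂ] B :=
  ∑ e : T, ((ContinuousLinearMap.mul ℂ B).flip (star (ρ.ψ (basis κ hκ e 1)))).comp
    ((ρ.ψ.mkContinuous 1 fun x => by rw [one_mul]; exact ρ.norm_ψ_le x).comp
      (ContinuousLinearMap.apply ℂ _ (basis κ hκ e 1)))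

theorem psiOne_apply (S : freeCorrespondence κ hκ →L[ℂ] freeCorrespondence κ hκ) :
    psiOne hκ ρ S = ∑ e, ρ.ψ (S (basis κ hκ e 1)) * star (ρ.ψ (basis κ hκ e 1)) := by
  rw [psiOne, sum_apply]
  rfl

/-- Reconstruct `y = ∑ t_e ⟨t_e, y⟩`: then `∑ ψ(x) π(⟨y, t_e⟩) ψ(t_e)*` is `ψ(x) ψ(y)*`. -/
theorem psiOne_theta (x y : freeCorrespondence κ hκ) :
    psiOne hκ ρ (theta x y) = ρ.ψ x * star (ρ.ψ y) := by
  rw [psiOne_apply]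
  conv_rhs => rw [← sum_basis κ hκ y]
  rw [map_sum, star_sum, Finset.mul_sum]
  refine Finset.sum_congr rfl fun e _ => ?_
  change ρ.ψ (rmul x (ip y (basis κ hκ e 1))) * _ = _
  rw [ρ.map_right, ρ.map_right, star_mul, ← map_star ρ.π, star_ip, mul_assoc]

end freeCorrespondence

/-- Left linearity pulls `π(a)` out of the sum: `∑ ψ(φ(a) t_e) ψ(t_e)* = π(a) ∑ s_e s_e* = π(a)`.
The identity holds for every `a` in `C*(H)`. -/
theorem ExelPardoFamily.isCovariant_toeplitzRep [Fintype T] [Nonempty T] {B : Type v} [CStarAlgebra B]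
    (F : ExelPardoFamily (oneVertexAction H T) κ B)
    (hκ : ∀ g h e, κ (g * h) e = κ g (h • e) * κ h e) : (F.toeplitzRep hκ).IsCovariant := by
  refine ⟨(freeCorrespondence.psiOne hκ (F.toeplitzRep hκ)).comp
    (freeCorrespondence κ hκ).compacts.subtypeL,
    freeCorrespondence.psiOne_theta hκ _, fun a _ => ?_⟩
  refine (freeCorrespondence.psiOne_apply hκ _ _).trans ?_
  change ∑ e : T, F.ψ hκ ((freeCorrespondence κ hκ).φ a (freeCorrespondence.basis κ hκ e 1)) *
    star (F.ψ hκ (freeCorrespondence.basis κ hκ e 1)) = F.π a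
  have h1 : F.π 1 = 1 := by rw [← GroupCStar.u_one, F.π_u, map_one]
  simp only [F.ψ_φ, F.ψ_basis, h1, mul_one, mul_assoc]
  rw [← Finset.mul_sum, F.sum_mul_star, mul_one]

/-! ### The Exel-Pardo family of a covariant representation -/

namespace freeCorrespondence

variable [Fintype T] (hκ : ∀ g h e, κ (g * h) e = κ g (h • e) * κ h e)
  {B : Type u} [NonUnitalCStarAlgebra B] (ρ : (freeCorrespondence κ hκ).ToeplitzRep B)

theorem star_π_one : star (ρ.π 1) = ρ.π 1 := by rw [← map_star, star_one]

theorem π_one_mul_self : ρ.π 1 * ρ.π 1 = ρ.π 1 := by rw [← map_mul, mul_one]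

theorem π_mem_corner (a : GroupCStar H) : ρ.π a ∈ corner (ρ.π 1) (star_π_one hκ ρ) :=
  ⟨by rw [← map_mul, one_mul], by rw [← map_mul, mul_one]⟩

/-- The unit of `C*(H)` acts as the identity on both sides of `t_e a`, so `π(1)` is a unit for its
image. -/
theorem ψ_basis_mem_corner (e : T) (a : GroupCStar H) :
    ρ.ψ (basis κ hκ e a) ∈ corner (ρ.π 1) (star_π_one hκ ρ) :=
  ⟨by rw [← ρ.map_left, φ_one]; rfl, by rw [← ρ.map_right, rmul_basis, mul_one]⟩

/-- This is covariance at `a = 1`, with `φ(1)` written as the sum of the `θ_{t_e, t_e}`.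
Faithfulness enters only to place `1` in the Katsura ideal. -/
theorem sum_ψ_mul_star (hφ : ∀ b, (freeCorrespondence κ hκ).φ b = 0 → b = 0)
    (hρ : ρ.IsCovariant) :
    ∑ e, ρ.ψ (basis κ hκ e 1) * star (ρ.ψ (basis κ hκ e 1)) = ρ.π 1 := by
  obtain ⟨ψ₁, h1, h2⟩ := hρ
  rw [← h2 1 (one_mem_katsuraIdeal κ hκ hφ)]
  have h3 : (⟨(freeCorrespondence κ hκ).φ 1, (one_mem_katsuraIdeal κ hκ hφ).1⟩ :
      (freeCorrespondence κ hκ).compacts) = ∑ e, thetaK (basis κ hκ e 1) (basis κ hκ e 1) :=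
    Subtype.ext (sum_thetaK κ hκ).symm
  rw [h3, map_sum]
  exact Finset.sum_congr rfl fun e _ => (h1 _ _).symm

/-- The Exel-Pardo family of a covariant representation, in the corner of `π(1)`. -/
def family (hφ : ∀ b, (freeCorrespondence κ hκ).φ b = 0 → b = 0) (hρ : ρ.IsCovariant) :
    letI := cornerCStarAlgebra (ρ.π 1) (star_π_one hκ ρ) (π_one_mul_self hκ ρ)
    ExelPardoFamily (oneVertexAction H T) κ (corner (ρ.π 1) (star_π_one hκ ρ)) :=
  letI := cornerCStarAlgebra (ρ.π 1) (star_π_one hκ ρ) (π_one_mul_self hκ ρ)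
  -- This is the unit of the corner, that is, `π(1)`.
  { p := fun _ => 1
    s := fun e => ⟨ρ.ψ (basis κ hκ e 1), ψ_basis_mem_corner hκ ρ e 1⟩
    u :=
      { toFun := fun h => ⟨ρ.π (GroupCStar.u h), π_mem_corner hκ ρ _⟩
        map_one' := Subtype.ext (congrArg ρ.π GroupCStar.u_one)
        map_mul' := fun g h => Subtype.ext <|
          (congrArg ρ.π (GroupCStar.u_mul g h)).trans (map_mul ρ.π _ _) }
    star_p := fun _ => star_one _
    p_mul_p := fun _ => mul_one _
    p_orthogonal := fun v w hvw => absurd (Subsingleton.elim (α := PUnit) v w) hvw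
    sum_p := finsum_unique (α := PUnit) _
    star_s_mul_s := fun e => Subtype.ext <| by
      classical
      refine (ρ.map_ip (basis κ hκ e 1) (basis κ hκ e 1)).trans ?_
      rw [ip_basis, if_pos rfl, star_one, mul_one]
      rfl
    sum_s_mul_star_s := fun v _ =>
      (finsum_oneVertexGraph (B := corner (ρ.π 1) (star_π_one hκ ρ)) v fun e =>
        (⟨ρ.ψ (basis κ hκ e 1), ψ_basis_mem_corner hκ ρ e 1⟩ : corner _ _) *
          star (⟨ρ.ψ (basis κ hκ e 1), ψ_basis_mem_corner hκ ρ e 1⟩ : corner _ _)).trans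
      (Subtype.ext ((AddSubmonoidClass.coe_finsetSum _ _).trans (sum_ψ_mul_star hκ ρ hφ hρ)))
    star_u := fun h => Subtype.ext <|
      (map_star ρ.π _).symm.trans (congrArg ρ.π (GroupCStar.star_u h))
    -- Both sides equal `ψ(t_{he} u_{κ(h,e)})`: the left by left linearity, the right by right
    -- linearity.
    u_mul_s := fun h e => Subtype.ext <| by
      refine (ρ.map_left (GroupCStar.u h) (basis κ hκ e 1)).symm.trans ?_
      rw [φ_u_basis, mul_one]
      refine Eq.trans ?_ (ρ.map_right (basis κ hκ (h • e) 1) (GroupCStar.u (κ h e)))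
      rw [rmul_basis, one_mul]
    u_mul_p := fun h v => (mul_one _).trans (one_mul _).symm }

/-- The Exel-Pardo representation of a covariant representation. -/
def exelPardoRep (hφ : ∀ b, (freeCorrespondence κ hκ).φ b = 0 → b = 0)
    (σ : (freeCorrespondence κ hκ).CovariantRep) : ExelPardoRep (oneVertexAction H T) κ :=
  letI := cornerCStarAlgebra (σ.rep.π 1) (star_π_one hκ σ.rep) (π_one_mul_self hκ σ.rep)
  { B := corner (σ.rep.π 1) (star_π_one hκ σ.rep)
    family := family hκ σ.rep hφ σ.covariant }

/-- The inclusion of the corner. -/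
def exelPardoRepIncl (hφ : ∀ b, (freeCorrespondence κ hκ).φ b = 0 → b = 0)
    (σ : (freeCorrespondence κ hκ).CovariantRep) : (exelPardoRep hκ hφ σ).B →⋆ₙₐ[ℂ] σ.B where
  toFun := Subtype.val
  map_smul' _ _ := rfl
  map_zero' := rfl
  map_add' _ _ := rfl
  map_mul' _ _ := rfl
  map_star' _ := rfl

/-- The covariant representation of an Exel-Pardo family. -/
def covariantRep [Nonempty T] (σ : ExelPardoRep (oneVertexAction H T) κ) :
    (freeCorrespondence κ hκ).CovariantRep where
  B := σ.B
  rep := σ.family.toeplitzRep hκ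
  covariant := σ.family.isCovariant_toeplitzRep hκ

/-- If the left action is faithful, the Cuntz-Pimsner algebra of the correspondence of a cocycle on
a finite set is the Exel-Pardo algebra. -/
theorem nonempty_cuntzPimsner_equiv_exelPardoAlgebra [Nonempty T]
    [Finite (oneVertexGraph T).Vertex] [Finite (oneVertexGraph T).Edge]
    (hφ : ∀ b, (freeCorrespondence κ hκ).φ b = 0 → b = 0) :
    Nonempty ((freeCorrespondence κ hκ).CuntzPimsner ≃⋆ₐ[ℂ]
      ExelPardoAlgebra (oneVertexAction H T) κ) := by
  -- The coordinate of `Φ` at a family is the coordinate at its covariant representation. `Ψ` reads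
  -- the family in the corner and includes the corner in the ambient algebra.
  let Φ : (freeCorrespondence κ hκ).CovariantProduct →⋆ₙₐ[ℂ]
      ExelPardoProduct (oneVertexAction H T) κ :=
    lpPullback (B := fun σ : (freeCorrespondence κ hκ).CovariantRep => σ.B)
      (C := fun σ : ExelPardoRep (oneVertexAction H T) κ => σ.B) (covariantRep hκ)
      fun σ => NonUnitalStarAlgHom.id ℂ σ.B
  let Ψ : ExelPardoProduct (oneVertexAction H T) κ →⋆ₙₐ[ℂ]
      (freeCorrespondence κ hκ).CovariantProduct :=
    lpPullback (B := fun σ : ExelPardoRep (oneVertexAction H T) κ => σ.B)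
      (C := fun σ : (freeCorrespondence κ hκ).CovariantRep => σ.B) (exelPardoRep hκ hφ)
      (exelPardoRepIncl hκ hφ)
  have hΦs : ∀ e, Φ ((freeCorrespondence κ hκ).kX (basis κ hκ e 1)) =
      universalS (oneVertexAction H T) κ e :=
    fun e => lp.ext <| funext fun σ => by
      refine (σ.family.ψ_basis hκ e 1).trans ?_
      -- `ψ(t_e 1) = s_e π(1)`, and `π(1) = u_1 = 1` in a family.
      rw [← GroupCStar.u_one, σ.family.π_u, map_one, mul_one]
      rfl
  have hΦu : ∀ h, Φ ((freeCorrespondence κ hκ).kA (GroupCStar.u h)) =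
      universalU (oneVertexAction H T) κ h :=
    fun h => lp.ext <| funext fun σ => σ.family.π_u h
  have hΨs : ∀ e, Ψ (universalS (oneVertexAction H T) κ e) =
      (freeCorrespondence κ hκ).kX (basis κ hκ e 1) :=
    fun e => rfl
  have hΨu : ∀ h, Ψ (universalU (oneVertexAction H T) κ h) =
      (freeCorrespondence κ hκ).kA (GroupCStar.u h) :=
    fun h => rfl
  -- The only projection is `1 = u_1`, so it adds no generator beyond the unitaries.
  have hp : ∀ v, universalP (oneVertexAction H T) κ v = universalU (oneVertexAction H T) κ 1 :=
    fun v => lp.ext <| funext fun σ => (σ.family.p_eq_one v).trans (map_one σ.family.u).symm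
  refine nonempty_starAlgEquiv_of_generators (cuntzPimsnerSubalgebra_eq κ hκ) rfl Φ Ψ ?_ ?_ ?_ ?_
  · have hsub := (NonUnitalStarAlgebra.subset_adjoin ℂ _).trans
      (NonUnitalStarSubalgebra.le_topologicalClosure (NonUnitalStarAlgebra.adjoin ℂ
        (Set.range (universalP (oneVertexAction H T) κ) ∪
          Set.range (universalS (oneVertexAction H T) κ) ∪
          Set.range (universalU (oneVertexAction H T) κ))))
    rintro _ (⟨e, rfl⟩ | ⟨h, rfl⟩)
    · change Φ ((freeCorrespondence κ hκ).kX (basis κ hκ e 1)) ∈ _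
      rw [hΦs]
      exact hsub (Or.inl (Or.inr ⟨e, rfl⟩))
    · change Φ ((freeCorrespondence κ hκ).kA (GroupCStar.u h)) ∈ _
      rw [hΦu]
      exact hsub (Or.inr ⟨h, rfl⟩)
  · have hu : ∀ h, Ψ (universalU (oneVertexAction H T) κ h) ∈
      (freeCorrespondence κ hκ).cuntzPimsnerSubalgebra :=
      fun h => NonUnitalStarSubalgebra.le_topologicalClosure _
        (NonUnitalStarAlgebra.subset_adjoin ℂ _ (Or.inr ⟨_, (hΨu h).symm⟩))
    rintro _ ((⟨v, rfl⟩ | ⟨e, rfl⟩) | ⟨h, rfl⟩)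
    · rw [hp]
      exact hu 1
    · exact NonUnitalStarSubalgebra.le_topologicalClosure _
        (NonUnitalStarAlgebra.subset_adjoin ℂ _ (Or.inl ⟨_, (hΨs e).symm⟩))
    · exact hu h
  · rintro _ (⟨e, rfl⟩ | ⟨h, rfl⟩)
    · exact (congrArg Ψ (hΦs e)).trans (hΨs e)
    · exact (congrArg Ψ (hΦu h)).trans (hΨu h)
  · rintro _ ((⟨v, rfl⟩ | ⟨e, rfl⟩) | ⟨h, rfl⟩)
    · rw [hp]
      exact (congrArg Φ (hΨu 1)).trans (hΦu 1)
    · exact (congrArg Φ (hΨs e)).trans (hΦs e)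
    · exact (congrArg Φ (hΨu h)).trans (hΦu h)

end freeCorrespondence

end Families

/-! ### Faithfulness of the left action -/

section Subgroup

open Correspondence

variable {G : Type u} [Group G] (H : Subgroup G) (η : G ⧸ H → G) (hη : ∀ x, (η x : G ⧸ H) = x)

/-- The left action of `C*(H)` on the correspondence of the subgroup `H` is faithful: on the coset
`H` it is conjugate to left multiplication. -/
theorem eq_zero_of_φ_sectionCocycle_eq_zero [Fintype (G ⧸ H)] (b : GroupCStar H)
    (hb : (freeCorrespondence (sectionCocycle H η hη) (sectionCocycle_mul H η hη)).φ b = 0) :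
    b = 0 := by
  classical
  let κ := sectionCocycle H η hη
  let hκ := sectionCocycle_mul H η hη
  let o : G ⧸ H := ((1 : G) : G ⧸ H)
  have ho : ∀ h : H, h • o = o := fun h => by
    change (((h : G) * 1 : G) : G ⧸ H) = ((1 : G) : G ⧸ H)
    exact QuotientGroup.eq.2 (by simp)
  -- The section value on the trivial coset lies in `H`. As `H` fixes this coset, the cocycle there
  -- is conjugation by `k`.
  let k : H := ⟨η o, by
    have h1 := QuotientGroup.eq.1 (hη o).symm
    rwa [inv_one, one_mul] at h1⟩
  have hk : ∀ h, κ h o = k⁻¹ * h * k := fun h => by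
    ext
    change (η (h • o))⁻¹ * (h : G) * η o = (η o)⁻¹ * h * η o
    rw [ho]
  have key : ∀ a, (freeCorrespondence κ hκ).φ a (freeCorrespondence.basis κ hκ o 1) =
      freeCorrespondence.basis κ hκ o (GroupCStar.u k⁻¹ * a * GroupCStar.u k) := by
    intro a
    refine GroupCStar.induction_u (P := fun a =>
      (freeCorrespondence κ hκ).φ a (freeCorrespondence.basis κ hκ o 1) =
        freeCorrespondence.basis κ hκ o (GroupCStar.u k⁻¹ * a * GroupCStar.u k)) a
      (isClosed_eq (freeCorrespondence.continuous_φ_apply κ hκ _)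
        ((freeCorrespondence.continuous_basis κ hκ o).comp
          ((continuous_const.mul continuous_id).mul continuous_const))) ?_ (fun a b ha hb => ?_)
      (fun c a ha => ?_) fun h => ?_
    · rw [map_zero, mul_zero, zero_mul]
      exact (map_zero (FreeModule.single o)).symm
    · rw [map_add, add_apply, ha, hb, mul_add, add_mul, freeCorrespondence.basis_add]
    · rw [map_smul, smul_apply, ha, mul_smul_comm, smul_mul_assoc]
      exact (map_smul (FreeModule.single o) c _).symm
    · rw [freeCorrespondence.φ_u_basis, ho, mul_one, hk, GroupCStar.u_mul, GroupCStar.u_mul]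
  have h0 := key b
  rw [hb] at h0
  have h1 : GroupCStar.u k⁻¹ * b * GroupCStar.u k = 0 := by
    -- Pairing with `t_o` reads off the coefficient at `o`; conjugating back by the unitary `u k`
    -- then recovers `b`.
    have h2 := congrArg (ip (freeCorrespondence.basis κ hκ o 1)) h0
    rw [freeCorrespondence.ip_basis, if_pos rfl, star_one, one_mul] at h2
    rw [← h2]
    have := ip_smul (0 : ℂ) (freeCorrespondence.basis κ hκ o 1) (freeCorrespondence.basis κ hκ o 1)
    rwa [zero_smul, zero_smul] at this
  calc b = GroupCStar.u k * (GroupCStar.u k⁻¹ * b * GroupCStar.u k) * GroupCStar.u k⁻¹ := by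
        rw [mul_assoc, mul_assoc, mul_assoc, ← GroupCStar.u_mul, mul_inv_cancel, ← mul_assoc,
          ← GroupCStar.u_mul, mul_inv_cancel, GroupCStar.u_one, one_mul, mul_one]
    _ = 0 := by rw [h1, mul_zero, zero_mul]

end Subgroup

end

/-! ### The main theorem -/

theorem mainTheorem4 {G : Type*} [Group G] (H : Subgroup G)
    (η : G ⧸ H → G) (hη : ∀ x, (η x : G ⧸ H) = x) :
    (∃ hκ : (oneVertexAction H (G ⧸ H)).IsCocycle (sectionCocycle H η hη),
      Nonempty (Correspondence.Iso (subgroupCorrespondence H)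
        (exelPardoCorrespondence (sectionCocycle H η hη) hκ)) ∧
      Nonempty ((subgroupCorrespondence H).CuntzPimsner ≃⋆ₐ[ℂ]
        (exelPardoCorrespondence (sectionCocycle H η hη) hκ).CuntzPimsner)) ∧
    (H.FiniteIndex →
      ∃ (_ : Finite (oneVertexGraph (G ⧸ H)).Vertex) (_ : Finite (oneVertexGraph (G ⧸ H)).Edge)
        (hκ : (oneVertexAction H (G ⧸ H)).IsExelPardoCocycle (sectionCocycle H η hη)),
        Nonempty (Correspondence.Iso (subgroupCorrespondence H)
          (exelPardoModule (sectionCocycle H η hη) hκ)) ∧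
        Nonempty ((subgroupCorrespondence H).CuntzPimsner ≃⋆ₐ[ℂ]
          ExelPardoAlgebra (oneVertexAction H (G ⧸ H)) (sectionCocycle H η hη))) := by
  have hκ := isCocycle_sectionCocycle H η hη
  obtain ⟨T⟩ := nonempty_iso_exelPardoCorrespondence H η hη hκ
  refine ⟨⟨hκ, ⟨T⟩, T.nonempty_cuntzPimsner_equiv⟩, fun hH => ?_⟩
  have hE : Finite (oneVertexGraph (G ⧸ H)).Edge := inferInstanceAs (Finite (G ⧸ H))
  refine ⟨inferInstanceAs (Finite PUnit), hE, isExelPardoCocycle_sectionCocycle H η hη, ?_⟩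
  -- `exelPardoModule` uses this same `Fintype` structure, so `T'` below is definitionally an
  -- isomorphism onto it.
  let _ : Fintype (G ⧸ H) := Fintype.ofFinite (G ⧸ H)
  obtain ⟨T'⟩ := nonempty_iso_ofUnitary_freeModule H η hη
  obtain ⟨e⟩ := T'.nonempty_cuntzPimsner_equiv
  obtain ⟨e'⟩ := freeCorrespondence.nonempty_cuntzPimsner_equiv_exelPardoAlgebra
    (sectionCocycle_mul H η hη) (eq_zero_of_φ_sectionCocycle_eq_zero H η hη)
  exact ⟨⟨T'⟩, ⟨e.trans e'⟩⟩
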